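/- Throughout, $[0,1]$ carries Lebesgue measure and $L^0=L^0[0,1]$ is the vector lattice of real measurable functions modulo a.e. equality. An *Orlicz function* is a convex, increasing (not necessarily strictly), non-constant function $\varphi:[0,\infty)\to[0,\infty)$ with $\varphi(0)=0$; its conjugate is $\varphi^*(s)=\sup\{st-\varphi(t):t\ge 0\}\in[0,\infty]$, $s\ge 0$. The Orlicz space $L^\varphi=L^\varphi[0,1]$ is the normed lattice of all $f\in L^0$ with $\|f\|_\varphi=\inf\{\lambda>0:\int_0^1\varphi(|f|/\lambda)\,dt\le 1\}<\infty$. The function $\varphi^*$ has the $\Delta_2$-condition if there are $C>0$ and $t_0>0$ with $\varphi^*(2t)\le C\varphi^*(t)$ for all $t>t_0$ (so if $\varphi^*$ fails the $\Delta_2$-condition, then $\varphi^*$ is finite-valued). For a Banach lattice $X$, a net $(f_\alpha)$ order converges to $f$ in $X$ if there is a net $h_\gamma\downarrow 0$ in $X$ such that for every $\gamma$ there is $\alpha_0$ with $|f_\alpha-f|\le h_\gamma$ for all $\alpha\ge\alpha_0$. Let $X_n^\sim$ be the set of all linear functionals $g$ on $X$ with $g(f_\alpha)\to 0$ for every net $(f_\alpha)$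 that order converges to $0$, and let $\sigma_n=\sigma(X,X_n^\sim)$ be the topology on $X$ of pointwise convergence on $X_n^\sim$. The space $X$ has $\sigma_n$-$oBSP$ (the $\sigma_n$-order Banach–Saks property) if every norm bounded $\sigma_n$-null sequence in $X$ has a subsequence $(f_{n_k})$ whose Cesàro sequence $\frac1m\sum_{k=1}^m f_{n_k}$ order converges in $X$. **Proposition 5.5.** Let $X=L^1[0,1]$, or $X=L^\varphi[0,1]$ where $\varphi$ is an Orlicz function such that $\varphi^*$ fails the $\Delta_2$-condition. Then $X$ fails $\sigma_n$-$oBSP$. -/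

import Mathlib

open MeasureTheory Filter Topology
open scoped ENNReal NNReal

universe u

/-! ### Order convergence, the order continuous dual and the order Banach-Saks property -/

section BanachLattice

/-- Order convergence of a net `f` to `x` in a vector lattice `X`: there is a net `h` decreasing
to `0` (its index set is a nonempty directed set, possibly different from that of `f`) such that
for every `γ` one has `|f a - x| ≤ h γ` for all sufficiently large `a`. -/
def OrderConverges {X : Type u} [Lattice X] [AddCommGroup X] {A : Type*} [Preorder A]
    (f : A → X) (x : X) : Prop :=
  ∃ (Γ : Type u) (_ : Preorder Γ) (_ : IsDirectedOrder Γ) (_ : Nonempty Γ) (h : Γ → X),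
    Antitone h ∧ IsGLB (Set.range h) 0 ∧ ∀ γ, ∃ a₀, ∀ a, a₀ ≤ a → |f a - x| ≤ h γ

/-- A linear functional `g` is order continuous if `g (f a) → 0` for every net `f` that order
converges to `0`. -/
def IsOrderContinuous {X : Type u} [Lattice X] [AddCommGroup X] [Module ℝ X]
    (g : X →ₗ[ℝ] ℝ) : Prop :=
  ∀ (A : Type u) [Preorder A] [IsDirectedOrder A] [Nonempty A] (f : A → X),
    OrderConverges f 0 → Tendsto (fun a => g (f a)) atTop (𝓝 0)

/-- The order continuous dual of `X`, as a set of linear functionals. -/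
def orderContinuousDual (X : Type u) [Lattice X] [AddCommGroup X] [Module ℝ X] :
    Set (X →ₗ[ℝ] ℝ) :=
  {g | IsOrderContinuous g}

/-- The topology `σ(X, I)` of pointwise convergence on a set `I` of linear functionals. -/
abbrev sigmaTopology {X : Type u} [AddCommGroup X] [Module ℝ X] (I : Set (X →ₗ[ℝ] ℝ)) :
    TopologicalSpace X :=
  TopologicalSpace.induced (fun (x : X) (g : I) => (g : X →ₗ[ℝ] ℝ) x) inferInstance

/-- The Cesàro sequence `f 0, (f 0 + f 1) / 2, (f 0 + f 1 + f 2) / 3, …` of a sequence `f`. -/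
noncomputable def cesaro {X : Type u} [AddCommGroup X] [Module ℝ X] (f : ℕ → X) (m : ℕ) : X :=
  ((m : ℝ) + 1)⁻¹ • ∑ n ∈ Finset.range (m + 1), f n

/-- The `τ`-order Banach-Saks property of a normed lattice `X`: every norm bounded sequence which
is `τ`-null has a subsequence whose Cesàro sequence order converges in `X`. -/
def HasOrderBanachSaks (X : Type u) [NormedAddCommGroup X] [NormedSpace ℝ X] [Lattice X]
    [IsOrderedAddMonoid X] [HasSolidNorm X] (τ : TopologicalSpace X) : Prop :=
  ∀ f : ℕ → X, (∃ M : ℝ, ∀ n, ‖f n‖ ≤ M) → Tendsto f atTop (@nhds X τ 0) →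
    ∃ k : ℕ → ℕ, StrictMono k ∧ ∃ x : X, OrderConverges (cesaro (f ∘ k)) x

/-- The `σ_n`-order Banach-Saks property, where `σ_n = σ(X, X_n^∼)` is the weak topology induced
by the order continuous dual. -/
def HasSigmaNOrderBanachSaks (X : Type u) [NormedAddCommGroup X] [NormedSpace ℝ X] [Lattice X]
    [IsOrderedAddMonoid X] [HasSolidNorm X] : Prop :=
  HasOrderBanachSaks X (sigmaTopology (orderContinuousDual X))

end BanachLattice

/-! ### Orlicz functions -/

/-- An Orlicz function `φ : [0,∞) → [0,∞)`: convex, increasing (not necessarily strictly),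
non-constant and with `φ 0 = 0`. -/
structure OrliczFunction where
  toFun : ℝ≥0 → ℝ≥0
  convex : ConvexOn ℝ≥0 Set.univ toFun
  mono : Monotone toFun
  nonconst : ∃ s t, toFun s ≠ toFun t
  map_zero : toFun 0 = 0

namespace OrliczFunction

instance : CoeFun OrliczFunction (fun _ => ℝ≥0 → ℝ≥0) := ⟨toFun⟩

/-- The conjugate `φ* s = sup {s t - φ t : t ≥ 0}`, with values in `[0,∞]`. Subtraction in
`[0,∞]` is truncated at `0`; this does not change the supremum, as `t = 0` contributes `0`. -/
noncomputable def conj (φ : OrliczFunction) (s : ℝ≥0) : ℝ≥0∞ :=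
  ⨆ t : ℝ≥0, ((s : ℝ≥0∞) * t - φ t)

end OrliczFunction

/-- The `Δ₂`-condition for a function `ψ : [0,∞) → [0,∞]`: there are `C > 0` and `t₀ > 0` with
`ψ (2 t) ≤ C ψ t` for all `t > t₀`. If `ψ` is increasing and takes the value `∞`, the condition
holds, so that an increasing `ψ` failing it is finite-valued. -/
def DeltaTwo (ψ : ℝ≥0 → ℝ≥0∞) : Prop :=
  ∃ C t₀ : ℝ≥0, 0 < C ∧ 0 < t₀ ∧ ∀ t, t₀ < t → ψ (2 * t) ≤ C * ψ t

/-! ### Orlicz spaces -/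

section OrliczSpace

variable {α : Type u} [MeasurableSpace α]

/-- `∫ φ (|f| / c) dμ`. -/
noncomputable def orliczModular (φ : OrliczFunction) (μ : Measure α) (f : α →ₘ[μ] ℝ)
    (c : ℝ≥0) : ℝ≥0∞ :=
  ∫⁻ x, (φ (‖f x‖₊ / c) : ℝ≥0∞) ∂μ

/-- The Luxemburg norm `inf {c > 0 : ∫ φ (|f| / c) dμ ≤ 1}`, with value `∞` if there is no
such `c`. -/
noncomputable def luxemburgNorm (φ : OrliczFunction) (μ : Measure α) (f : α →ₘ[μ] ℝ) : ℝ≥0∞ :=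
  ⨅ (c : ℝ≥0) (_ : 0 < c ∧ orliczModular φ μ f c ≤ 1), (c : ℝ≥0∞)

variable {φ : OrliczFunction} {μ : Measure α}

theorem luxemburgNorm_le {f : α →ₘ[μ] ℝ} {c : ℝ≥0} (hc : 0 < c)
    (h : orliczModular φ μ f c ≤ 1) : luxemburgNorm φ μ f ≤ c :=
  iInf₂_le c ⟨hc, h⟩

theorem exists_of_luxemburgNorm_lt {f : α →ₘ[μ] ℝ} {a : ℝ≥0∞} (h : luxemburgNorm φ μ f < a) :
    ∃ c : ℝ≥0, 0 < c ∧ orliczModular φ μ f c ≤ 1 ∧ (c : ℝ≥0∞) < a := by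
  simp only [luxemburgNorm, iInf_lt_iff] at h
  obtain ⟨c, ⟨h1, h2⟩, h3⟩ := h
  exact ⟨c, h1, h2, h3⟩

theorem orliczModular_mono {f g : α →ₘ[μ] ℝ} (h : ∀ᵐ x ∂μ, ‖f x‖₊ ≤ ‖g x‖₊) (c : ℝ≥0) :
    orliczModular φ μ f c ≤ orliczModular φ μ g c := by
  refine lintegral_mono_ae ?_
  filter_upwards [h] with x hx
  exact ENNReal.coe_le_coe.2 (φ.mono (by gcongr))

theorem luxemburgNorm_mono {f g : α →ₘ[μ] ℝ} (h : ∀ᵐ x ∂μ, ‖f x‖₊ ≤ ‖g x‖₊) :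
    luxemburgNorm φ μ f ≤ luxemburgNorm φ μ g :=
  le_iInf₂ fun c hc => luxemburgNorm_le hc.1 ((orliczModular_mono h c).trans hc.2)

theorem luxemburgNorm_zero : luxemburgNorm φ μ (0 : α →ₘ[μ] ℝ) = 0 := by
  refine le_antisymm (ENNReal.le_of_forall_pos_le_add fun ε hε _ => ?_) zero_le
  rw [zero_add]
  refine luxemburgNorm_le hε ?_
  have h : orliczModular φ μ (0 : α →ₘ[μ] ℝ) ε = ∫⁻ _, 0 ∂μ := by
    refine lintegral_congr_ae ?_
    filter_upwards [AEEqFun.coeFn_zero (μ := μ) (β := ℝ)] with x hx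
    simp [hx, φ.map_zero]
  simp [h]

theorem luxemburgNorm_neg (f : α →ₘ[μ] ℝ) : luxemburgNorm φ μ (-f) = luxemburgNorm φ μ f := by
  apply le_antisymm <;> refine luxemburgNorm_mono ?_ <;>
    filter_upwards [AEEqFun.coeFn_neg f] with x hx <;> simp [hx]

theorem luxemburgNorm_add_le (f g : α →ₘ[μ] ℝ) :
    luxemburgNorm φ μ (f + g) ≤ luxemburgNorm φ μ f + luxemburgNorm φ μ g := by
  refine ENNReal.le_of_forall_pos_le_add fun ε hε hfin => ?_
  obtain ⟨hf, hg⟩ := ENNReal.add_lt_top.1 hfin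
  have hε2 : ((ε / 2 : ℝ≥0) : ℝ≥0∞) ≠ 0 := by simpa using hε.ne'
  obtain ⟨a, ha, hfa, ha'⟩ := exists_of_luxemburgNorm_lt (ENNReal.lt_add_right hf.ne hε2)
  obtain ⟨b, hb, hgb, hb'⟩ := exists_of_luxemburgNorm_lt (ENNReal.lt_add_right hg.ne hε2)
  have hab : 0 < a + b := add_pos ha hb
  have key : orliczModular φ μ (f + g) (a + b) ≤ 1 := by
    have h1 : orliczModular φ μ (f + g) (a + b) ≤
        ∫⁻ x, (((a / (a + b) : ℝ≥0) : ℝ≥0∞) * (φ (‖f x‖₊ / a) : ℝ≥0∞) +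
          ((b / (a + b) : ℝ≥0) : ℝ≥0∞) * (φ (‖g x‖₊ / b) : ℝ≥0∞)) ∂μ := by
      refine lintegral_mono_ae ?_
      filter_upwards [AEEqFun.coeFn_add f g] with x hx
      have hsum : a / (a + b) + b / (a + b) = 1 := by
        rw [← add_div, div_self hab.ne']
      have hc := φ.convex.2 (Set.mem_univ (‖f x‖₊ / a)) (Set.mem_univ (‖g x‖₊ / b))
        (zero_le (a := a / (a + b))) (zero_le (a := b / (a + b))) hsum
      have hm : φ (‖(f + g : α →ₘ[μ] ℝ) x‖₊ / (a + b)) ≤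
          φ ((a / (a + b)) • (‖f x‖₊ / a) + (b / (a + b)) • (‖g x‖₊ / b)) := by
        refine φ.mono ?_
        have e : (a / (a + b)) • (‖f x‖₊ / a) + (b / (a + b)) • (‖g x‖₊ / b) =
            (‖f x‖₊ + ‖g x‖₊) / (a + b) := by
          simp only [smul_eq_mul]
          field_simp
        rw [e, hx]
        gcongr
        exact nnnorm_add_le _ _
      exact_mod_cast hm.trans hc
    refine h1.trans ?_
    have hmeas : AEMeasurable (fun x => (φ (‖f x‖₊ / a) : ℝ≥0∞)) μ :=
      (φ.mono.measurable.comp_aemeasurable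
        (f.aestronglyMeasurable.aemeasurable.nnnorm.div_const a)).coe_nnreal_ennreal
    rw [lintegral_add_left' (hmeas.const_mul _), lintegral_const_mul' _ _ ENNReal.coe_ne_top,
      lintegral_const_mul' _ _ ENNReal.coe_ne_top]
    calc _ ≤ ((a / (a + b) : ℝ≥0) : ℝ≥0∞) * 1 + ((b / (a + b) : ℝ≥0) : ℝ≥0∞) * 1 := by
          gcongr
          · exact hfa
          · exact hgb
      _ = 1 := by
          rw [mul_one, mul_one, ← ENNReal.coe_add, ← add_div, div_self hab.ne', ENNReal.coe_one]
  refine (luxemburgNorm_le hab key).trans ?_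
  calc ((a + b : ℝ≥0) : ℝ≥0∞) = a + b := ENNReal.coe_add _ _
    _ ≤ (luxemburgNorm φ μ f + (ε / 2 : ℝ≥0)) + (luxemburgNorm φ μ g + (ε / 2 : ℝ≥0)) := by
        gcongr
    _ = luxemburgNorm φ μ f + luxemburgNorm φ μ g + ((ε / 2 + ε / 2 : ℝ≥0) : ℝ≥0∞) := by
        push_cast; ring
    _ = _ := by rw [add_halves]

theorem luxemburgNorm_smul_le (r : ℝ) (f : α →ₘ[μ] ℝ) :
    luxemburgNorm φ μ (r • f) ≤ ‖r‖₊ * luxemburgNorm φ μ f := by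
  rcases eq_or_ne r 0 with rfl | hr
  · simp [luxemburgNorm_zero]
  have hr' : 0 < ‖r‖₊ := nnnorm_pos.2 hr
  rw [mul_comm, ← ENNReal.div_le_iff (by simpa using hr) ENNReal.coe_ne_top]
  refine le_iInf₂ fun c hc => ?_
  rw [ENNReal.div_le_iff (by simpa using hr) ENNReal.coe_ne_top, ← ENNReal.coe_mul]
  refine luxemburgNorm_le (mul_pos hc.1 hr') (le_trans (le_of_eq ?_) hc.2)
  refine lintegral_congr_ae ?_
  filter_upwards [AEEqFun.coeFn_smul r f] with x hx
  rw [hx, Pi.smul_apply, nnnorm_smul, mul_comm c, mul_div_mul_left _ _ hr'.ne']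

theorem eq_zero_of_luxemburgNorm_eq_zero {f : α →ₘ[μ] ℝ} (h : luxemburgNorm φ μ f = 0) :
    f = 0 := by
  have hmod : ∀ c : ℝ≥0, 0 < c → orliczModular φ μ f c ≤ 1 := by
    intro c hc
    obtain ⟨d, hd, hfd, hdc⟩ := exists_of_luxemburgNorm_lt (φ := φ) (f := f) (a := c)
      (by rw [h]; exact_mod_cast hc)
    refine le_trans (lintegral_mono fun x => ?_) hfd
    refine ENNReal.coe_le_coe.2 (φ.mono ?_)
    have : d ≤ c := by exact_mod_cast hdc.le
    gcongr
  obtain ⟨t, ht⟩ : ∃ t, 0 < φ t := by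
    by_contra! hcon
    obtain ⟨s, t, hst⟩ := φ.nonconst
    exact hst ((nonpos_iff_eq_zero.1 (hcon s)).trans (nonpos_iff_eq_zero.1 (hcon t)).symm)
  have ht0 : 0 < t := by
    rcases eq_or_ne t 0 with rfl | h0
    · simp [φ.map_zero] at ht
    · exact pos_iff_ne_zero.2 h0
  have hgrow : ∀ N : ℕ, N * φ t ≤ φ (N * t) := by
    intro N
    rcases Nat.eq_zero_or_pos N with rfl | hN
    · simp
    have hN' : (0 : ℝ≥0) < N := by exact_mod_cast hN
    have hN1 : (N : ℝ≥0)⁻¹ ≤ 1 := inv_le_one_of_one_le₀ (by exact_mod_cast hN)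
    have hc := φ.convex.2 (Set.mem_univ ((N : ℝ≥0) * t)) (Set.mem_univ 0)
      (zero_le (a := (N : ℝ≥0)⁻¹)) (zero_le (a := 1 - (N : ℝ≥0)⁻¹)) (add_tsub_cancel_of_le hN1)
    simp only [smul_eq_mul, mul_zero, add_zero, φ.map_zero, inv_mul_cancel_left₀ hN'.ne'] at hc
    calc (N : ℝ≥0) * φ t ≤ N * ((N : ℝ≥0)⁻¹ * φ (N * t)) := by gcongr
      _ = φ (N * t) := mul_inv_cancel_left₀ hN'.ne' _
  have hnull : ∀ ε : ℝ≥0, 0 < ε → μ {x | ε ≤ ‖f x‖₊} = 0 := by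
    intro ε hε
    have hbd : ∀ N : ℕ, (N : ℝ≥0∞) * (φ t * μ {x | ε ≤ ‖f x‖₊}) ≤ 1 := by
      intro N
      rcases Nat.eq_zero_or_pos N with rfl | hN
      · simp
      have hN' : (0 : ℝ≥0) < N := by exact_mod_cast hN
      have hc : 0 < ε / (N * t) := div_pos hε (mul_pos hN' ht0)
      have hmeas : AEMeasurable (fun x => (φ (‖f x‖₊ / (ε / (N * t))) : ℝ≥0∞)) μ :=
        (φ.mono.measurable.comp_aemeasurable
          (f.aestronglyMeasurable.aemeasurable.nnnorm.div_const _)).coe_nnreal_ennreal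
      have hmk := mul_meas_ge_le_lintegral₀ hmeas (φ (N * t) : ℝ≥0∞)
      have hsub : μ {x | ε ≤ ‖f x‖₊} ≤
          μ {x | (φ (N * t) : ℝ≥0∞) ≤ φ (‖f x‖₊ / (ε / (N * t)))} := by
        refine measure_mono fun x hx => ENNReal.coe_le_coe.2 (φ.mono ?_)
        rw [le_div_iff₀ hc, mul_div_cancel₀ _ (mul_pos hN' ht0).ne']
        exact hx
      calc (N : ℝ≥0∞) * (φ t * μ {x | ε ≤ ‖f x‖₊})
          = ((N * φ t : ℝ≥0) : ℝ≥0∞) * μ {x | ε ≤ ‖f x‖₊} := by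
            push_cast; rw [mul_assoc]
        _ ≤ (φ (N * t) : ℝ≥0∞) * μ {x | (φ (N * t) : ℝ≥0∞) ≤ φ (‖f x‖₊ / (ε / (N * t)))} := by
            gcongr
            exact hgrow N
        _ ≤ 1 := hmk.trans (hmod _ hc)
    by_contra hne
    have hpos : (φ t : ℝ≥0∞) * μ {x | ε ≤ ‖f x‖₊} ≠ 0 :=
      mul_ne_zero (by exact_mod_cast ht.ne') hne
    obtain ⟨N, hN⟩ := ENNReal.exists_nat_mul_gt hpos ENNReal.one_ne_top
    exact absurd (hbd N) (not_le.2 hN)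
  refine AEEqFun.ext ?_
  have hall : ∀ᵐ x ∂μ, ∀ n : ℕ, ¬ (((n : ℝ≥0) + 1)⁻¹ ≤ ‖f x‖₊) := by
    rw [ae_all_iff]
    intro n
    rw [ae_iff]
    simpa using hnull (((n : ℝ≥0) + 1)⁻¹) (by positivity)
  filter_upwards [hall, AEEqFun.coeFn_zero (μ := μ) (β := ℝ)] with x hx h0
  rw [h0]
  by_contra hfx
  have hp : (0 : ℝ) < ‖f x‖₊ := by simpa using hfx
  obtain ⟨n, hn⟩ := exists_nat_one_div_lt hp
  refine hx n ?_
  rw [← NNReal.coe_le_coe]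
  simpa using hn.le

variable (φ μ) in
/-- The Orlicz space `L^φ(μ)`: all (classes of) real measurable functions whose Luxemburg norm is
finite, as a linear subspace of `L⁰(μ)`. -/
def OrliczSpace : Submodule ℝ (α →ₘ[μ] ℝ) where
  carrier := {f | luxemburgNorm φ μ f < ∞}
  add_mem' {f g} hf hg :=
    (luxemburgNorm_add_le f g).trans_lt (ENNReal.add_lt_top.2 ⟨hf, hg⟩)
  zero_mem' := by simp [luxemburgNorm_zero]
  smul_mem' r f hf :=
    (luxemburgNorm_smul_le r f).trans_lt (ENNReal.mul_lt_top ENNReal.coe_lt_top hf)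

namespace OrliczSpace

/-- `L^φ(μ)` with the a.e. pointwise order is a lattice. -/
noncomputable instance instLattice : Lattice (OrliczSpace φ μ) :=
  Subtype.lattice
    (fun f g hf hg => by
      have hf' : |f| ∈ OrliczSpace φ μ :=
        (luxemburgNorm_mono (by
          filter_upwards [AEEqFun.coeFn_abs f] with x hx; simp [hx])).trans_lt hf
      have hg' : |g| ∈ OrliczSpace φ μ :=
        (luxemburgNorm_mono (by
          filter_upwards [AEEqFun.coeFn_abs g] with x hx; simp [hx])).trans_lt hg
      refine (luxemburgNorm_mono ?_).trans_lt ((OrliczSpace φ μ).add_mem hf' hg')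
      filter_upwards [AEEqFun.coeFn_sup f g, AEEqFun.coeFn_add |f| |g|, AEEqFun.coeFn_abs f,
        AEEqFun.coeFn_abs g] with x h1 h2 h3 h4
      rw [h1, h2, Pi.add_apply, h3, h4, ← NNReal.coe_le_coe, coe_nnnorm, coe_nnnorm,
        Real.norm_of_nonneg (add_nonneg (abs_nonneg _) (abs_nonneg _))]
      exact norm_sup_le_add (f x) (g x))
    (fun f g hf hg => by
      have hf' : |f| ∈ OrliczSpace φ μ :=
        (luxemburgNorm_mono (by
          filter_upwards [AEEqFun.coeFn_abs f] with x hx; simp [hx])).trans_lt hf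
      have hg' : |g| ∈ OrliczSpace φ μ :=
        (luxemburgNorm_mono (by
          filter_upwards [AEEqFun.coeFn_abs g] with x hx; simp [hx])).trans_lt hg
      refine (luxemburgNorm_mono ?_).trans_lt ((OrliczSpace φ μ).add_mem hf' hg')
      filter_upwards [AEEqFun.coeFn_inf f g, AEEqFun.coeFn_add |f| |g|, AEEqFun.coeFn_abs f,
        AEEqFun.coeFn_abs g] with x h1 h2 h3 h4
      rw [h1, h2, Pi.add_apply, h3, h4, ← NNReal.coe_le_coe, coe_nnnorm, coe_nnnorm,
        Real.norm_of_nonneg (add_nonneg (abs_nonneg _) (abs_nonneg _))]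
      exact norm_inf_le_add (f x) (g x))

/-- `L^φ(μ)` is normed by the Luxemburg norm. -/
noncomputable instance instNormedAddCommGroup : NormedAddCommGroup (OrliczSpace φ μ) :=
  AddGroupNorm.toNormedAddCommGroup
    { toFun := fun f => (luxemburgNorm φ μ (f : α →ₘ[μ] ℝ)).toReal
      map_zero' := by simp [luxemburgNorm_zero]
      add_le' := fun f g => by
        rw [← ENNReal.toReal_add (ne_of_lt f.2) (ne_of_lt g.2)]
        exact ENNReal.toReal_mono (ENNReal.add_ne_top.2 ⟨ne_of_lt f.2, ne_of_lt g.2⟩)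
          (luxemburgNorm_add_le _ _)
      neg' := fun f => by simp [luxemburgNorm_neg]
      eq_zero_of_map_eq_zero' := fun f hf => by
        rcases (ENNReal.toReal_eq_zero_iff _).1 hf with h | h
        · exact Subtype.ext (eq_zero_of_luxemburgNorm_eq_zero h)
        · exact absurd h (ne_of_lt f.2) }

theorem norm_def (f : OrliczSpace φ μ) :
    ‖f‖ = (luxemburgNorm φ μ (f : α →ₘ[μ] ℝ)).toReal := rfl

noncomputable instance instNormedSpace : NormedSpace ℝ (OrliczSpace φ μ) where
  norm_smul_le r f := by
    rw [norm_def, norm_def, ← coe_nnnorm r, ← ENNReal.coe_toReal, ← ENNReal.toReal_mul]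
    exact ENNReal.toReal_mono (ENNReal.mul_ne_top ENNReal.coe_ne_top (ne_of_lt f.2))
      (luxemburgNorm_smul_le r _)

instance instIsOrderedAddMonoid : IsOrderedAddMonoid (OrliczSpace φ μ) where
  add_le_add_left f g hfg h := by
    have hfg' : (f : α →ₘ[μ] ℝ) ≤ g := hfg
    change (f : α →ₘ[μ] ℝ) + h ≤ g + h
    rw [← AEEqFun.coeFn_le] at hfg' ⊢
    filter_upwards [hfg', AEEqFun.coeFn_add (f : α →ₘ[μ] ℝ) h,
      AEEqFun.coeFn_add (g : α →ₘ[μ] ℝ) h] with x h1 h2 h3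
    rw [h2, h3, Pi.add_apply, Pi.add_apply]
    gcongr

instance instHasSolidNorm : HasSolidNorm (OrliczSpace φ μ) where
  solid f g hfg := by
    have hfg' : |(f : α →ₘ[μ] ℝ)| ≤ |(g : α →ₘ[μ] ℝ)| := hfg
    rw [← AEEqFun.coeFn_le] at hfg'
    refine ENNReal.toReal_mono (ne_of_lt g.2) (luxemburgNorm_mono ?_)
    filter_upwards [hfg', AEEqFun.coeFn_abs (f : α →ₘ[μ] ℝ),
      AEEqFun.coeFn_abs (g : α →ₘ[μ] ℝ)] with x h1 h2 h3
    rw [h2, h3] at h1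
    rw [← NNReal.coe_le_coe]
    exact h1

end OrliczSpace

end OrliczSpace

/-!
A convex `φ` whose conjugate fails `Δ₂` is, up to a factor `2`, linear on intervals `[t, ℓ t]` with
`ℓ` and `t` as large as desired (`isNearlyLinear_of_not_deltaTwo_conj`), and so is `φ t = t`, for
which `L^φ = L¹`. Only this property is used, so that both cases are one.

Near linearity yields a random variable `F ≥ 0` in `L^φ` such that the maximal function
`sup_n F_n / n` of independent copies `F_n` of `F` is not in `L^φ`: a value `a` taken with a small
probability `p` gives `F_n / n ≥ a / n` on a set of probability `p`, essentially disjoint for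
different `n` below `1 / p`, so the modular of the maximal function is at least about
`∑ p φ (a / n)`. As `φ` is nearly linear on `[a / ℓ, a]`, this is about `p φ a ∑ 1 / n`, a factor
`log ℓ` more than the contribution `p φ a` of the value `a` to the modular of `F`
(`IsNearlyLinear.exists_layer`, `IsNearlyLinear.exists_distribution`). If the Cesàro means of a
subsequence order converged, then `F_n / n` along it would be order bounded, which is thus
impossible (`IsIID.not_forall_le_linear_growth`).

It remains to see that `F_n - E F` is `σ_n`-null (`IsIID.tendsto_map`). This needs no representation
of the order continuous functionals, only that dominated almost everywhere convergence implies order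
convergence (`OrliczSpace.orderConverges_zero_of_dominated`). For bounded i.i.d. sequences the
strong law of large numbers makes the Cesàro means of every subsequence order convergent to the
mean, hence a functional converges along the sequence itself (`IsIID.tendsto_of_bounded`). The tails
of the `F_n` are uniformly small under the functional: sufficiently far tails of any choice of the
`F_n` have a supremum in `L^φ`, hence order converge to `0` (`IsIID.exists_forall_abs_tail_lt`).
-/

/-! ### Orlicz functions that are nearly linear on long intervals -/

theorem exists_harmonic_sum_gt (j : ℕ) (B : ℝ≥0) :
    ∃ L : ℕ, j < L ∧ B < ∑ m ∈ Finset.Ico j L, ((m : ℝ≥0) + 1)⁻¹ := by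
  have h1 := Real.tendsto_sum_range_one_div_nat_succ_atTop.eventually_gt_atTop
    (B + ∑ i ∈ Finset.range j, (1 / (i + 1) : ℝ))
  obtain ⟨L, hL, hjL⟩ := (h1.and (eventually_gt_atTop j)).exists
  refine ⟨L, hjL, ?_⟩
  rw [← Finset.sum_range_add_sum_Ico _ hjL.le] at hL
  have h2 : (B : ℝ) < ∑ i ∈ Finset.Ico j L, (1 / (i + 1) : ℝ) := by linarith
  rw [← NNReal.coe_lt_coe]
  push_cast
  simpa only [one_div] using h2

namespace OrliczFunction

variable (φ : OrliczFunction)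

/-- `φ` is nearly linear on arbitrarily long intervals `[t, ℓ t]` arbitrarily far out: on such an
interval its slope `φ s / s` at most doubles. -/
def IsNearlyLinear : Prop :=
  ∀ l T : ℝ≥0, 1 ≤ l → ∃ t, T < t ∧ φ (l * t) < 2 * l * φ t

/-- A convex function vanishing at `0` is superhomogeneous. -/
theorem mul_le_map_mul {r : ℝ≥0} (hr : 1 ≤ r) (t : ℝ≥0) : r * φ t ≤ φ (r * t) := by
  have hr0 : 0 < r := one_pos.trans_le hr
  have hr1 : r⁻¹ ≤ 1 := inv_le_one_of_one_le₀ hr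
  have hc := φ.convex.2 (Set.mem_univ (r * t)) (Set.mem_univ 0)
    (zero_le (a := r⁻¹)) (zero_le (a := 1 - r⁻¹)) (add_tsub_cancel_of_le hr1)
  simp only [smul_eq_mul, mul_zero, add_zero, φ.map_zero, inv_mul_cancel_left₀ hr0.ne'] at hc
  calc r * φ t ≤ r * (r⁻¹ * φ (r * t)) := by gcongr
    _ = φ (r * t) := mul_inv_cancel_left₀ hr0.ne' _

theorem exists_pos : ∃ t, 0 < t ∧ 0 < φ t := by
  obtain ⟨t, ht⟩ : ∃ t, 0 < φ t := by
    by_contra! hcon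
    obtain ⟨s, t, hst⟩ := φ.nonconst
    exact hst ((nonpos_iff_eq_zero.1 (hcon s)).trans (nonpos_iff_eq_zero.1 (hcon t)).symm)
  refine ⟨t, pos_iff_ne_zero.2 fun h => ?_, ht⟩
  simp [h, φ.map_zero] at ht

theorem exists_one_le : ∃ t, 0 < t ∧ 1 ≤ φ t := by
  obtain ⟨t, ht, hφ⟩ := φ.exists_pos
  refine ⟨(max 1 (φ t)⁻¹) * t, by positivity, ?_⟩
  calc 1 = (φ t)⁻¹ * φ t := (inv_mul_cancel₀ hφ.ne').symm
    _ ≤ max 1 (φ t)⁻¹ * φ t := by gcongr; exact le_max_right _ _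
    _ ≤ _ := φ.mul_le_map_mul (le_max_left _ _) _

/-- Rescaling `φ (ℓ t) ≥ 2 ℓ φ t` (for large `t`) under the supremum defining the conjugate gives
`φ* (2 s) ≤ 2 ℓ φ* s` up to a term linear in `s`, which `φ*` dominates. -/
theorem isNearlyLinear_of_not_deltaTwo_conj (h : ¬ DeltaTwo φ.conj) : φ.IsNearlyLinear := by
  intro l T hl
  by_contra! hcon
  have hl0 : 0 < l := one_pos.trans_le hl
  refine h ⟨2 * l + 4 * l * T, 2 * φ 1 + 1, by positivity, by positivity, fun s hs => ?_⟩
  have hlin : (s : ℝ≥0∞) ≤ 2 * φ.conj s := by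
    have h1 : (s : ℝ≥0∞) * (1 : ℝ≥0) - φ 1 ≤ φ.conj s :=
      le_iSup (fun t : ℝ≥0 => (s : ℝ≥0∞) * t - φ t) 1
    refine le_trans ?_ (mul_le_mul_right h1 2)
    rw [ENNReal.coe_one, mul_one]
    have h2 : 2 * φ 1 ≤ s := (le_self_add).trans hs.le
    have h3 : s ≤ 2 * (s - φ 1) := by
      rw [mul_tsub, two_mul s, add_tsub_assoc_of_le h2]
      exact le_self_add
    exact_mod_cast h3
  refine iSup_le fun v => ?_
  rcases le_or_gt v (l * T) with hv | hv
  · calc ((2 * s : ℝ≥0) : ℝ≥0∞) * v - φ v ≤ ((2 * s : ℝ≥0) : ℝ≥0∞) * v := tsub_le_self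
      _ ≤ ((2 * s : ℝ≥0) : ℝ≥0∞) * ((l * T : ℝ≥0) : ℝ≥0∞) := by gcongr
      _ = 2 * (l * T) * s := by push_cast; ring
      _ ≤ 2 * (l * T) * (2 * φ.conj s) := by gcongr
      _ = (4 * l * T) * φ.conj s := by ring
      _ ≤ ((2 * l + 4 * l * T : ℝ≥0) : ℝ≥0∞) * φ.conj s := by
        push_cast
        gcongr
        exact le_add_self
  · obtain ⟨u, rfl⟩ : ∃ u, v = l * u := ⟨v / l, by field_simp⟩
    have hu : T < u := lt_of_mul_lt_mul_left hv (zero_le)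
    have h1 : (2 * s) * (l * u) - φ (l * u) ≤ 2 * l * (s * u - φ u) := by
      rw [mul_tsub, show 2 * l * (s * u) = (2 * s) * (l * u) by ring]
      exact tsub_le_tsub_left (hcon u hu) _
    calc ((2 * s : ℝ≥0) : ℝ≥0∞) * ((l * u : ℝ≥0) : ℝ≥0∞) - φ (l * u)
        ≤ 2 * l * ((s : ℝ≥0∞) * u - φ u) := by exact_mod_cast h1
      _ ≤ 2 * l * φ.conj s := by
        gcongr
        exact le_iSup (fun t : ℝ≥0 => (s : ℝ≥0∞) * t - φ t) u
      _ ≤ ((2 * l + 4 * l * T : ℝ≥0) : ℝ≥0∞) * φ.conj s := by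
        push_cast
        gcongr
        exact le_self_add

/-- The size `a`, the probability `p` and the horizon `L` of one layer of the random variables used
below. The layer is light for the modular, but the sum of the values `φ (a / (j (m + 1)))`, which
bounds from below the modular of the maximal function of independent copies, is large: all the
arguments lie in an interval where `φ` is nearly linear, so that the sum is almost harmonic. -/
theorem IsNearlyLinear.exists_layer {φ : OrliczFunction} (h : φ.IsNearlyLinear) {j : ℕ}
    (hj : 1 ≤ j) {η : ℝ≥0} (hη : 0 < η) :
    ∃ (a p : ℝ≥0) (L : ℕ), p ≤ η ∧ p * φ a ≤ η ∧ p * a ≤ η ∧ p * L ≤ 2⁻¹ ∧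
      2 < ∑ m ∈ Finset.Ico j L, p * φ (a / (j * (m + 1))) := by
  obtain ⟨T, hT, hφT⟩ := φ.exists_one_le
  -- `ε` is the contribution `p φ a` of the layer to the modular; `a ≤ T φ a` bounds `p a` by `ε T`.
  set ε : ℝ≥0 := min 2⁻¹ (min η (η / T)) with hε
  have hε0 : 0 < ε := by positivity
  have hj0 : (0 : ℝ≥0) < j := by exact_mod_cast hj
  obtain ⟨L, hjL, hL⟩ := exists_harmonic_sum_gt j (4 * j / ε)
  have hjL1 : 1 ≤ (j : ℝ≥0) * L := by exact_mod_cast Nat.mul_pos hj (by omega : 0 < L)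
  obtain ⟨t, ht, hnl⟩ := h (j * L) T hjL1
  have ht0 : 0 < t := hT.trans ht
  have hφt : 1 ≤ φ t := hφT.trans (φ.mono ht.le)
  set a : ℝ≥0 := j * L * t with ha
  have hLφ : j * L * φ t ≤ φ a := φ.mul_le_map_mul hjL1 t
  have hφa1 : 1 ≤ φ a := hφt.trans (φ.mono (le_mul_of_one_le_left zero_le hjL1))
  have hφa : 0 < φ a := one_pos.trans_le hφa1
  have hpa : ε / φ a * φ a = ε := div_mul_cancel₀ _ hφa.ne'
  refine ⟨a, ε / φ a, L, ?_, ?_, ?_, ?_, ?_⟩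
  · exact (div_le_self zero_le hφa1).trans ((min_le_right _ _).trans (min_le_left _ _))
  · rw [hpa]
    exact (min_le_right _ _).trans (min_le_left _ _)
  · have haT : 1 ≤ a / T := by
      rw [one_le_div hT]
      exact ht.le.trans (le_mul_of_one_le_left zero_le hjL1)
    have h1 : a / T ≤ φ a := by
      calc a / T = a / T * 1 := (mul_one _).symm
        _ ≤ a / T * φ T := by gcongr
        _ ≤ φ (a / T * T) := φ.mul_le_map_mul haT T
        _ = φ a := by rw [div_mul_cancel₀ _ hT.ne']
    have h2 : a ≤ φ a * T := (div_le_iff₀ hT).1 h1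
    calc ε / φ a * a ≤ ε / φ a * (φ a * T) := by gcongr
      _ = ε * T := by rw [← mul_assoc, hpa]
      _ ≤ η / T * T := by
        gcongr
        exact (min_le_right _ _).trans (min_le_right _ _)
      _ = η := div_mul_cancel₀ _ hT.ne'
  · rw [div_mul_eq_mul_div, div_le_iff₀ hφa]
    have h1 : (L : ℝ≥0) ≤ φ a := by
      refine le_trans ?_ hLφ
      calc (L : ℝ≥0) = 1 * L * 1 := by ring
        _ ≤ j * L * φ t := by gcongr; exact_mod_cast hj
    exact mul_le_mul (min_le_left _ _) h1 zero_le zero_le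
  · have hterm : ∀ m ∈ Finset.Ico j L,
        ε / (2 * j) * ((m : ℝ≥0) + 1)⁻¹ ≤ ε / φ a * φ (a / (j * (m + 1))) := by
      intro m hm
      have hm1 : (m : ℝ≥0) + 1 ≤ L := by exact_mod_cast (Finset.mem_Ico.1 hm).2
      have hm0 : (0 : ℝ≥0) < m + 1 := by positivity
      have hr : 1 ≤ (L : ℝ≥0) / (m + 1) := (one_le_div hm0).2 hm1
      have h1 : (L : ℝ≥0) / (m + 1) * φ t ≤ φ (a / (j * (m + 1))) := by
        refine (φ.mul_le_map_mul hr t).trans (le_of_eq ?_)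
        congr 1
        rw [ha]
        field_simp
      have h2 : φ a * (2 * j * ((m : ℝ≥0) + 1))⁻¹ ≤ φ (a / (j * (m + 1))) := by
        refine le_trans ?_ h1
        calc φ a * (2 * j * ((m : ℝ≥0) + 1))⁻¹
            ≤ (2 * (j * L) * φ t) * (2 * j * ((m : ℝ≥0) + 1))⁻¹ := by gcongr
          _ = (L : ℝ≥0) / (m + 1) * φ t := by field_simp
      calc ε / (2 * j) * ((m : ℝ≥0) + 1)⁻¹
          = ε / φ a * (φ a * (2 * j * ((m : ℝ≥0) + 1))⁻¹) := by field_simp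
        _ ≤ _ := by gcongr
    refine lt_of_lt_of_le ?_ (Finset.sum_le_sum hterm)
    rw [← Finset.mul_sum]
    calc (2 : ℝ≥0) = ε / (2 * j) * (4 * j / ε) := by field_simp; norm_num
      _ < _ := by gcongr

end OrliczFunction
/-! ### Order convergence in Orlicz spaces -/

namespace OrliczSpace

variable {α : Type u} [MeasurableSpace α] {φ : OrliczFunction} {μ : Measure α}

theorem le_iff_ae {f g : OrliczSpace φ μ} :
    f ≤ g ↔ ∀ᵐ x ∂μ, (f : α →ₘ[μ] ℝ) x ≤ (g : α →ₘ[μ] ℝ) x :=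
  (AEEqFun.coeFn_le (f := (f : α →ₘ[μ] ℝ)) (g := (g : α →ₘ[μ] ℝ))).symm

theorem coeFn_abs (f : OrliczSpace φ μ) :
    ∀ᵐ x ∂μ, ((|f| : OrliczSpace φ μ) : α →ₘ[μ] ℝ) x = |(f : α →ₘ[μ] ℝ) x| :=
  AEEqFun.coeFn_abs (f : α →ₘ[μ] ℝ)

theorem coeFn_add (f g : OrliczSpace φ μ) : ∀ᵐ x ∂μ,
    ((f + g : OrliczSpace φ μ) : α →ₘ[μ] ℝ) x = (f : α →ₘ[μ] ℝ) x + (g : α →ₘ[μ] ℝ) x :=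
  AEEqFun.coeFn_add (f : α →ₘ[μ] ℝ) g

theorem coeFn_smul (r : ℝ) (f : OrliczSpace φ μ) : ∀ᵐ x ∂μ,
    ((r • f : OrliczSpace φ μ) : α →ₘ[μ] ℝ) x = r * (f : α →ₘ[μ] ℝ) x :=
  AEEqFun.coeFn_smul r (f : α →ₘ[μ] ℝ)

theorem coeFn_sum (f : ℕ → OrliczSpace φ μ) (n : ℕ) : ∀ᵐ x ∂μ,
    ((∑ i ∈ Finset.range n, f i : OrliczSpace φ μ) : α →ₘ[μ] ℝ) x =
      ∑ i ∈ Finset.range n, (f i : α →ₘ[μ] ℝ) x := by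
  induction n with
  | zero =>
    filter_upwards [AEEqFun.coeFn_zero (μ := μ) (β := ℝ)] with x hx
    simp [hx]
  | succ n ih =>
    filter_upwards [ih, coeFn_add (∑ i ∈ Finset.range n, f i) (f n)] with x h1 h2
    rw [Finset.sum_range_succ, Finset.sum_range_succ, h2, h1]

theorem coeFn_cesaro (f : ℕ → OrliczSpace φ μ) (m : ℕ) : ∀ᵐ x ∂μ,
    ((cesaro f m : OrliczSpace φ μ) : α →ₘ[μ] ℝ) x =
      ((m : ℝ) + 1)⁻¹ * ∑ i ∈ Finset.range (m + 1), (f i : α →ₘ[μ] ℝ) x := by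
  filter_upwards [coeFn_smul ((m : ℝ) + 1)⁻¹ (∑ i ∈ Finset.range (m + 1), f i),
    coeFn_sum f (m + 1)] with x h1 h2
  rw [← h2, ← h1, cesaro]

theorem mem_of_ae_abs_le {f : α →ₘ[μ] ℝ} {g : OrliczSpace φ μ}
    (h : ∀ᵐ x ∂μ, |f x| ≤ (g : α →ₘ[μ] ℝ) x) : f ∈ OrliczSpace φ μ := by
  refine (luxemburgNorm_mono ?_).trans_lt g.2
  filter_upwards [h] with x hx
  rw [← NNReal.coe_le_coe]
  exact hx.trans (le_abs_self _)

theorem luxemburgNorm_mk_le_one {F : α → ℝ} (hF : AEStronglyMeasurable F μ)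
    (h : ∫⁻ x, (φ ‖F x‖₊ : ℝ≥0∞) ∂μ ≤ 1) : luxemburgNorm φ μ (AEEqFun.mk F hF) ≤ 1 := by
  have h1 : orliczModular φ μ (AEEqFun.mk F hF) 1 ≤ 1 := by
    refine le_trans (le_of_eq (lintegral_congr_ae ?_)) h
    filter_upwards [AEEqFun.coeFn_mk F hF] with x hx
    rw [hx, div_one]
  simpa using luxemburgNorm_le one_pos h1

theorem const_mem [IsProbabilityMeasure μ] (r : ℝ) :
    (AEEqFun.const α r : α →ₘ[μ] ℝ) ∈ OrliczSpace φ μ := by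
  have hc : 0 < (‖r‖₊ + 1) * (φ 1 + 1) := by positivity
  refine (luxemburgNorm_le hc ?_).trans_lt ENNReal.coe_lt_top
  have hle : φ (‖r‖₊ / ((‖r‖₊ + 1) * (φ 1 + 1))) ≤ 1 := by
    have h1 : ‖r‖₊ / ((‖r‖₊ + 1) * (φ 1 + 1)) ≤ (φ 1 + 1)⁻¹ := by
      rw [div_le_iff₀ hc, mul_comm (‖r‖₊ + 1), inv_mul_cancel_left₀ (by positivity)]
      exact le_self_add
    have h2 := φ.mul_le_map_mul (r := φ 1 + 1) le_add_self (φ 1 + 1)⁻¹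
    rw [mul_inv_cancel₀ (by positivity)] at h2
    have h3 : (φ 1 + 1) * φ (φ 1 + 1)⁻¹ ≤ (φ 1 + 1) * 1 := by
      rw [mul_one]; exact h2.trans le_self_add
    exact (φ.mono h1).trans (le_of_mul_le_mul_left h3 (by positivity))
  calc orliczModular φ μ (AEEqFun.const α r) _ ≤ ∫⁻ _, 1 ∂μ := by
        refine lintegral_mono_ae ?_
        filter_upwards [AEEqFun.coeFn_const (μ := μ) α r] with x hx
        rw [hx]
        exact_mod_cast hle
    _ = 1 := by simp

variable (φ μ) in
/-- The constant function with value `r`, as an element of `L^φ(μ)`. -/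
noncomputable def const [IsProbabilityMeasure μ] (r : ℝ) : OrliczSpace φ μ :=
  ⟨AEEqFun.const α r, const_mem r⟩

theorem coeFn_const [IsProbabilityMeasure μ] (r : ℝ) :
    ∀ᵐ x ∂μ, (const φ μ r : α →ₘ[μ] ℝ) x = r :=
  AEEqFun.coeFn_const α r

theorem const_eq_smul [IsProbabilityMeasure μ] (r : ℝ) : const φ μ r = r • const φ μ 1 := by
  refine Subtype.ext (AEEqFun.ext ?_)
  filter_upwards [coeFn_const (φ := φ) (μ := μ) r, coeFn_const (φ := φ) (μ := μ) 1,
    coeFn_smul r (const φ μ 1)] with x h1 h2 h3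
  rw [h1, h3, h2, mul_one]

/-- Dominated almost everywhere convergence to `0` implies order convergence: the suprema of the
tails decrease to `0` in `L^φ(μ)`. -/
theorem orderConverges_zero_of_dominated {α : Type} [MeasurableSpace α] {μ : Measure α}
    {f : ℕ → OrliczSpace φ μ} {V : OrliczSpace φ μ}
    (hV : ∀ n, ∀ᵐ x ∂μ, |(f n : α →ₘ[μ] ℝ) x| ≤ (V : α →ₘ[μ] ℝ) x)
    (hlim : ∀ᵐ x ∂μ, Tendsto (fun n => (f n : α →ₘ[μ] ℝ) x) atTop (𝓝 0)) :
    OrderConverges f 0 := by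
  set H : ℕ → α → ℝ := fun n x => ⨆ i, |(f (n + i) : α →ₘ[μ] ℝ) x| with hH
  have hmeas : ∀ n, AEStronglyMeasurable (H n) μ := fun n =>
    (Measurable.iSup fun i => (f (n + i) : α →ₘ[μ] ℝ).measurable.norm).aestronglyMeasurable
  have hV' : ∀ᵐ x ∂μ, ∀ n, |(f n : α →ₘ[μ] ℝ) x| ≤ (V : α →ₘ[μ] ℝ) x := ae_all_iff.2 hV
  have hbdd : ∀ x, (∀ n, |(f n : α →ₘ[μ] ℝ) x| ≤ (V : α →ₘ[μ] ℝ) x) →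
      ∀ n, BddAbove (Set.range fun i => |(f (n + i) : α →ₘ[μ] ℝ) x|) := by
    rintro x hx n
    refine ⟨(V : α →ₘ[μ] ℝ) x, ?_⟩
    rintro _ ⟨i, rfl⟩
    exact hx _
  have hmem : ∀ n, AEEqFun.mk (H n) (hmeas n) ∈ OrliczSpace φ μ := by
    intro n
    refine mem_of_ae_abs_le (g := V) ?_
    filter_upwards [AEEqFun.coeFn_mk (H n) (hmeas n), hV'] with x h1 h2
    rw [h1, abs_of_nonneg (Real.iSup_nonneg fun i => abs_nonneg _)]
    exact ciSup_le fun i => h2 _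
  let h : ℕ → OrliczSpace φ μ := fun n => ⟨AEEqFun.mk (H n) (hmeas n), hmem n⟩
  have hh : ∀ n, ∀ᵐ x ∂μ, (h n : α →ₘ[μ] ℝ) x = H n x := fun n =>
    AEEqFun.coeFn_mk (H n) (hmeas n)
  have hlimH : ∀ᵐ x ∂μ, Tendsto (fun n => H n x) atTop (𝓝 0) := by
    filter_upwards [hlim] with x hx
    rw [Metric.tendsto_atTop]
    intro ε hε
    obtain ⟨N, hN⟩ := Metric.tendsto_atTop.1 hx (ε / 2) (half_pos hε)
    refine ⟨N, fun n hn => ?_⟩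
    have hle : H n x ≤ ε / 2 := ciSup_le fun i => by
      have := hN (n + i) (by omega)
      rw [Real.dist_eq, sub_zero] at this
      exact this.le
    rw [Real.dist_eq, sub_zero, abs_of_nonneg (Real.iSup_nonneg fun i => abs_nonneg _)]
    linarith
  refine ⟨ℕ, inferInstance, inferInstance, inferInstance, h, ?_, ⟨?_, ?_⟩, fun n => ⟨n, ?_⟩⟩
  · refine antitone_nat_of_succ_le fun n => le_iff_ae.2 ?_
    filter_upwards [hh n, hh (n + 1), hV'] with x h1 h2 h3
    rw [h1, h2]
    refine ciSup_le fun i => ?_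
    rw [show n + 1 + i = n + (1 + i) by omega]
    exact le_ciSup (hbdd x h3 n) (1 + i)
  · rintro _ ⟨n, rfl⟩
    refine le_iff_ae.2 ?_
    filter_upwards [hh n, AEEqFun.coeFn_zero (μ := μ) (β := ℝ)] with x h1 h2
    rw [h1]
    refine (le_of_eq h2).trans (Real.iSup_nonneg fun i => abs_nonneg _)
  · intro y hy
    have hy' : ∀ᵐ x ∂μ, ∀ n, (y : α →ₘ[μ] ℝ) x ≤ H n x := by
      refine ae_all_iff.2 fun n => ?_
      filter_upwards [hh n, le_iff_ae.1 (hy ⟨n, rfl⟩)] with x h1 h2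
      rwa [← h1]
    refine le_iff_ae.2 ?_
    filter_upwards [hy', hlimH, AEEqFun.coeFn_zero (μ := μ) (β := ℝ)] with x h1 h2 h3
    exact (ge_of_tendsto' h2 h1).trans (le_of_eq h3.symm)
  · intro m hm
    rw [sub_zero]
    refine le_iff_ae.2 ?_
    filter_upwards [hh n, coeFn_abs (f m), hV'] with x h1 h2 h3
    rw [h1, h2]
    obtain ⟨i, rfl⟩ := Nat.exists_eq_add_of_le hm
    exact le_ciSup (hbdd x h3 n) i

theorem _root_.IsOrderContinuous.tendsto_of_dominated {α : Type} [MeasurableSpace α]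
    {μ : Measure α} {g : OrliczSpace φ μ →ₗ[ℝ] ℝ} (hg : IsOrderContinuous g)
    {f : ℕ → OrliczSpace φ μ} {V : OrliczSpace φ μ}
    (hV : ∀ n, ∀ᵐ x ∂μ, |(f n : α →ₘ[μ] ℝ) x| ≤ (V : α →ₘ[μ] ℝ) x)
    (hlim : ∀ᵐ x ∂μ, Tendsto (fun n => (f n : α →ₘ[μ] ℝ) x) atTop (𝓝 0)) :
    Tendsto (fun n => g (f n)) atTop (𝓝 0) :=
  hg ℕ f (orderConverges_zero_of_dominated hV hlim)

end OrliczSpace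

/-- If the Cesàro means of a sequence in a lattice ordered vector space order converge, the
sequence itself grows at most linearly with respect to the order. -/
theorem OrderConverges.exists_le_nsmul {X : Type u} [Lattice X] [AddCommGroup X] [Module ℝ X]
    [IsOrderedAddMonoid X] {f : ℕ → X} {x : X} (h : OrderConverges (cesaro f) x) :
    ∃ (H : X) (M : ℕ), ∀ m, M ≤ m → f m ≤ (2 * m + 2) • H := by
  obtain ⟨Γ, _, _, ⟨γ⟩, h, -, -, hf⟩ := h
  obtain ⟨m₀, hm₀⟩ := hf γ
  refine ⟨|h γ| + |x|, m₀ + 1, fun m hm => ?_⟩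
  obtain ⟨n, rfl⟩ : ∃ n, m = n + 1 := ⟨m - 1, by omega⟩
  have hc : ∀ k : ℕ, (k + 1) • cesaro f k = ∑ i ∈ Finset.range (k + 1), f i := by
    intro k
    rw [cesaro, ← Nat.cast_smul_eq_nsmul ℝ, smul_smul, Nat.cast_add_one,
      mul_inv_cancel₀ (by positivity), one_smul]
  have h1 : cesaro f (n + 1) - x ≤ |h γ| :=
    ((le_abs_self _).trans (hm₀ _ (by omega))).trans (le_abs_self _)
  have h2 : -(cesaro f n - x) ≤ |h γ| :=
    ((neg_le_abs _).trans (hm₀ _ (by omega))).trans (le_abs_self _)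
  have e : f (n + 1) = (n + 2) • (cesaro f (n + 1) - x) + (n + 1) • (-(cesaro f n - x)) + x := by
    have h3 : f (n + 1) = (n + 1 + 1) • cesaro f (n + 1) - (n + 1) • cesaro f n := by
      rw [hc, hc, Finset.sum_range_succ _ (n + 1), add_sub_cancel_left]
    rw [h3]
    module
  calc f (n + 1) ≤ (n + 2) • |h γ| + (n + 1) • |h γ| + |x| := by
        rw [e]
        exact add_le_add (add_le_add (nsmul_le_nsmul_right h1 _) (nsmul_le_nsmul_right h2 _))
          (le_abs_self x)
    _ ≤ (n + 2) • |h γ| + (n + 1) • |h γ| + |x| + (|h γ| + (2 * n + 3) • |x|) := by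
        refine le_add_of_nonneg_right (add_nonneg (abs_nonneg _) (nsmul_nonneg (abs_nonneg _) _))
    _ = (2 * (n + 1) + 2) • (|h γ| + |x|) := by module

/-! ### Passing from `L¹` to an Orlicz space -/

theorem orderConverges_iff_of_orderIso {X Y : Type u} [Lattice X] [AddCommGroup X] [Module ℝ X]
    [Lattice Y] [AddCommGroup Y] [Module ℝ Y] (e : X ≃ₗ[ℝ] Y) (he : ∀ x y, e x ≤ e y ↔ x ≤ y)
    {A : Type*} [Preorder A] (f : A → X) (x : X) :
    OrderConverges f x ↔ OrderConverges (fun a => e (f a)) (e x) := by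
  let o : X ≃o Y := ⟨e.toEquiv, fun {a b} => he a b⟩
  have habs : ∀ x, e |x| = |e x| := fun x => by
    change o (x ⊔ -x) = o x ⊔ -e x
    rw [o.map_sup, ← map_neg]
    rfl
  have hglb : ∀ {Γ : Type u} (h : Γ → X), IsGLB (Set.range h) 0 ↔
      IsGLB (Set.range fun γ => e (h γ)) 0 := by
    intro Γ h
    rw [show (fun γ => e (h γ)) = o ∘ h from rfl, Set.range_comp,
      show (0 : Y) = o 0 from (map_zero e).symm, o.isGLB_image']
  constructor
  · rintro ⟨Γ, i1, i2, i3, h, h1, h2, h3⟩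
    refine ⟨Γ, i1, i2, i3, fun γ => e (h γ), fun a b hab => (he _ _).2 (h1 hab),
      (hglb h).1 h2, fun γ => ?_⟩
    obtain ⟨a₀, ha⟩ := h3 γ
    refine ⟨a₀, fun a haa => ?_⟩
    rw [← map_sub, ← habs, he]
    exact ha a haa
  · rintro ⟨Γ, i1, i2, i3, h, h1, h2, h3⟩
    have hh : ∀ γ, e (e.symm (h γ)) = h γ := fun γ => e.apply_symm_apply _
    refine ⟨Γ, i1, i2, i3, fun γ => e.symm (h γ), fun a b hab => ?_, ?_, fun γ => ?_⟩
    · rw [← he, hh, hh]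
      exact h1 hab
    · rw [hglb]
      simpa only [hh] using h2
    · obtain ⟨a₀, ha⟩ := h3 γ
      refine ⟨a₀, fun a haa => ?_⟩
      rw [← he, hh, habs, map_sub]
      exact ha a haa

/-- The `σ_n`-order Banach-Saks property passes from `Y` to `X` along a contractive linear order
isomorphism. -/
theorem HasSigmaNOrderBanachSaks.of_orderIso {X Y : Type u}
    [NormedAddCommGroup X] [NormedSpace ℝ X] [Lattice X] [IsOrderedAddMonoid X] [HasSolidNorm X]
    [NormedAddCommGroup Y] [NormedSpace ℝ Y] [Lattice Y] [IsOrderedAddMonoid Y] [HasSolidNorm Y]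
    (e : X ≃ₗ[ℝ] Y) (he : ∀ x y, e x ≤ e y ↔ x ≤ y) (hn : ∀ x, ‖e x‖ ≤ ‖x‖)
    (hY : HasSigmaNOrderBanachSaks Y) : HasSigmaNOrderBanachSaks X := by
  rintro f ⟨M, hM⟩ hf
  obtain ⟨k, hk, y, hy⟩ := hY (fun n => e (f n)) ⟨M, fun n => (hn _).trans (hM n)⟩ (by
    rw [nhds_induced, tendsto_comap_iff, tendsto_pi_nhds] at hf ⊢
    rintro ⟨g, hg⟩
    have hg' : IsOrderContinuous (g ∘ₗ e.toLinearMap) := fun A _ _ _ f hf => by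
      have := (orderConverges_iff_of_orderIso e he f 0).1 hf
      rw [map_zero] at this
      exact hg A _ this
    simpa using hf ⟨_, hg'⟩)
  refine ⟨k, hk, e.symm y, ?_⟩
  rw [orderConverges_iff_of_orderIso e he, e.apply_symm_apply]
  convert hy using 2 with m
  simp [cesaro]

namespace OrliczFunction

/-- The Orlicz function `φ t = t`, for which `L^φ = L¹`. -/
def linear : OrliczFunction where
  toFun t := t
  convex := convexOn_id convex_univ
  mono _ _ h := h
  nonconst := ⟨0, 1, zero_ne_one⟩
  map_zero := rfl

theorem isNearlyLinear_linear : linear.IsNearlyLinear := by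
  intro l T hl
  refine ⟨T + 1, lt_add_one T, ?_⟩
  change l * (T + 1) < 2 * l * (T + 1)
  have : 0 < l * (T + 1) := mul_pos (one_pos.trans_le hl) (by positivity)
  calc l * (T + 1) < l * (T + 1) + l * (T + 1) := lt_add_of_pos_right _ this
    _ = _ := by ring

variable {α : Type u} [MeasurableSpace α] {μ : Measure α}

theorem orliczModular_linear (f : α →ₘ[μ] ℝ) {c : ℝ≥0} (hc : 0 < c) :
    orliczModular linear μ f c = eLpNorm f 1 μ / c := by
  rw [eLpNorm_one_eq_lintegral_enorm, div_eq_mul_inv,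
    ← lintegral_mul_const' _ _ (by simp [hc.ne'])]
  refine lintegral_congr fun x => ?_
  change ((‖f x‖₊ / c : ℝ≥0) : ℝ≥0∞) = _
  rw [ENNReal.coe_div hc.ne']
  rfl

theorem eLpNorm_le_luxemburgNorm_linear (f : α →ₘ[μ] ℝ) :
    eLpNorm f 1 μ ≤ luxemburgNorm linear μ f := by
  refine le_iInf₂ fun c hc => ?_
  have h := hc.2
  rw [orliczModular_linear f hc.1, ENNReal.div_le_iff (by simpa using hc.1.ne')
    ENNReal.coe_ne_top, one_mul] at h
  exact h

theorem mem_orliczSpace_linear_iff (f : α →ₘ[μ] ℝ) :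
    f ∈ OrliczSpace linear μ ↔ f ∈ Lp ℝ 1 μ := by
  rw [Lp.mem_Lp_iff_eLpNorm_lt_top]
  refine ⟨fun h => (eLpNorm_le_luxemburgNorm_linear f).trans_lt h, fun h => ?_⟩
  have hc : 0 < (eLpNorm f 1 μ).toNNReal + 1 := by positivity
  refine (luxemburgNorm_le hc ?_).trans_lt ENNReal.coe_lt_top
  rw [orliczModular_linear f hc, ENNReal.div_le_iff (by simp)
    ENNReal.coe_ne_top, one_mul, ENNReal.coe_add, ENNReal.coe_toNNReal h.ne]
  exact le_self_add

variable (μ) in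
/-- `L^φ(μ) = L¹(μ)` for `φ t = t`. -/
def linearEquivL1 : OrliczSpace linear μ ≃ₗ[ℝ] Lp ℝ 1 μ where
  toFun f := ⟨f, (mem_orliczSpace_linear_iff _).1 f.2⟩
  invFun f := ⟨f, (mem_orliczSpace_linear_iff _).2 f.2⟩
  map_add' _ _ := rfl
  map_smul' _ _ := rfl
  left_inv _ := rfl
  right_inv _ := rfl

theorem hasSigmaNOrderBanachSaks_linear
    (h : HasSigmaNOrderBanachSaks (Lp ℝ 1 μ)) :
    HasSigmaNOrderBanachSaks (OrliczSpace linear μ) :=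
  h.of_orderIso (linearEquivL1 μ) (fun _ _ => Iff.rfl) fun f =>
    ENNReal.toReal_mono (ne_of_lt f.2) (eLpNorm_le_luxemburgNorm_linear f.1)

end OrliczFunction
open ProbabilityTheory

/-! ### Cesàro means of real sequences -/

/-- A real sequence converges to `l` as soon as the Cesàro means of all its subsequences do: a
subsequence staying on one side of `l`, away from it, has its Cesàro means there too. -/
theorem tendsto_of_forall_tendsto_cesaro {y : ℕ → ℝ} {l : ℝ}
    (h : ∀ k : ℕ → ℕ, StrictMono k → Tendsto (cesaro (y ∘ k)) atTop (𝓝 l)) :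
    Tendsto y atTop (𝓝 l) := by
  have hconst : ∀ (c : ℝ) (m : ℕ), ((m : ℝ) + 1)⁻¹ * ∑ _ ∈ Finset.range (m + 1), c = c := by
    intro c m
    rw [Finset.sum_const, Finset.card_range, nsmul_eq_mul, Nat.cast_add_one,
      inv_mul_cancel_left₀ (by positivity)]
  refine tendsto_order.2 ⟨fun c hc => ?_, fun c hc => ?_⟩
  · by_contra hcon
    obtain ⟨k, hk, hyk⟩ := extraction_of_frequently_atTop (not_eventually.1 hcon)
    refine absurd (le_of_tendsto' (h k hk) (b := c) fun m => ?_) (not_le.2 hc)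
    rw [cesaro, smul_eq_mul]
    refine le_of_le_of_eq ?_ (hconst c m)
    gcongr
    exact not_lt.1 (hyk _)
  · by_contra hcon
    obtain ⟨k, hk, hyk⟩ := extraction_of_frequently_atTop (not_eventually.1 hcon)
    refine absurd (ge_of_tendsto' (h k hk) (b := c) fun m => ?_) (not_le.2 hc)
    rw [cesaro, smul_eq_mul]
    refine le_of_eq_of_le (hconst c m).symm ?_
    gcongr
    exact not_lt.1 (hyk _)

theorem map_cesaro {X : Type u} [AddCommGroup X] [Module ℝ X] (g : X →ₗ[ℝ] ℝ) (f : ℕ → X)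
    (m : ℕ) : g (cesaro f m) = cesaro (fun n => g (f n)) m := by
  simp [cesaro]

/-! ### Independent identically distributed sequences of natural numbers -/

/-- `J` is a sequence of pairwise independent `ℕ`-valued random variables with distribution `ν`. -/
structure IsIID {α : Type*} [MeasurableSpace α] (J : ℕ → α → ℕ) (ν : Measure ℕ)
    (μ : Measure α) : Prop where
  measurable : ∀ n, Measurable (J n)
  indep : Pairwise fun m n => IndepFun (J m) (J n) μ
  map_eq : ∀ n, μ.map (J n) = ν

theorem exists_isIID_unitInterval (ν : Measure ℕ) [IsProbabilityMeasure ν] :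
    ∃ J : ℕ → unitInterval → ℕ, IsIID J ν volume := by
  obtain ⟨f, hf, hmap⟩ := Measure.exists_measurable_map_eq (Measure.infinitePi fun _ : ℕ => ν)
  have hm : ∀ n, Measurable fun x => f x n := fun n => (measurable_pi_apply n).comp hf
  have hlaw : ∀ n, (volume : Measure unitInterval).map (fun x => f x n) = ν := fun n => by
    rw [← Measure.infinitePi_map_eval (fun _ : ℕ => ν) n, ← hmap,
      Measure.map_map (measurable_pi_apply n) hf]
    rfl
  have hind : iIndepFun (fun i x => f x i) (volume : Measure unitInterval) := by
    rw [iIndepFun_iff_map_fun_eq_infinitePi_map hm]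
    simp_rw [hlaw]
    exact hmap
  exact ⟨fun n x => f x n, hm, fun _ _ hmn => hind.indepFun hmn, hlaw⟩

namespace IsIID

variable {α : Type} [MeasurableSpace α] {J : ℕ → α → ℕ} {ν : Measure ℕ} {μ : Measure α}

theorem comp (hJ : IsIID J ν μ) {k : ℕ → ℕ} (hk : StrictMono k) :
    IsIID (fun n => J (k n)) ν μ :=
  ⟨fun _ => hJ.measurable _, fun _ _ hmn => hJ.indep (hk.injective.ne hmn), fun _ => hJ.map_eq _⟩

theorem lintegral_comp (hJ : IsIID J ν μ) (ψ : ℕ → ℝ≥0∞) (n : ℕ) :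
    ∫⁻ x, ψ (J n x) ∂μ = ∑' j, ψ j * ν {j} := by
  rw [← lintegral_countable', ← hJ.map_eq n,
    lintegral_map (measurable_of_countable ψ) (hJ.measurable n)]

theorem measure_eq (hJ : IsIID J ν μ) (n j : ℕ) : μ {x | J n x = j} = ν {j} := by
  rw [← hJ.map_eq n, Measure.map_apply (hJ.measurable n) (measurableSet_singleton j)]
  rfl

theorem measure_inter (hJ : IsIID J ν μ) {m n : ℕ} (hmn : m ≠ n) (j : ℕ) :
    μ ({x | J m x = j} ∩ {x | J n x = j}) = ν {j} * ν {j} := by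
  refine ((hJ.indep hmn).measure_inter_preimage_eq_mul {j} {j} (measurableSet_singleton j)
    (measurableSet_singleton j)).trans ?_
  exact congrArg₂ (· * ·) (hJ.measure_eq m j) (hJ.measure_eq n j)

/-- `∑ᵢ E(ψ(J); J ≥ i) = E((J + 1) ψ(J))`; only an inequality holds if the truncation at level `i`
is replaced by one at a higher level `K i`. -/
theorem tsum_lintegral_truncation_le (hJ : IsIID J ν μ) (ψ : ℕ → ℝ≥0∞) (n K : ℕ → ℕ)
    (hK : ∀ i, i ≤ K i) :
    ∑' i, ∫⁻ x, (if K i ≤ J (n i) x then ψ (J (n i) x) else 0) ∂μ ≤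
      ∑' j : ℕ, ((j : ℝ≥0∞) + 1) * ψ j * ν {j} := by
  have h1 : ∀ i, ∫⁻ x, (if K i ≤ J (n i) x then ψ (J (n i) x) else 0) ∂μ =
      ∑' j, (if K i ≤ j then ψ j else 0) * ν {j} := fun i =>
    hJ.lintegral_comp (fun j => if K i ≤ j then ψ j else 0) (n i)
  simp_rw [h1]
  rw [ENNReal.tsum_comm]
  refine ENNReal.tsum_le_tsum fun j => ?_
  rw [ENNReal.tsum_mul_right]
  gcongr
  calc ∑' i, (if K i ≤ j then ψ j else 0)
      ≤ ∑' i, (if i ∈ Finset.range (j + 1) then ψ j else 0) := by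
        refine ENNReal.tsum_le_tsum fun i => ?_
        split_ifs with h2 h3
        · exact le_rfl
        · exact absurd (Finset.mem_range.2 (Nat.lt_succ_of_le ((hK i).trans h2))) h3
        · exact zero_le
        · exact le_rfl
    _ = ((j : ℝ≥0∞) + 1) * ψ j := by
        rw [tsum_eq_sum (s := Finset.range (j + 1)) (fun i hi => by simp [hi])]
        rw [Finset.sum_congr rfl (fun i hi => if_pos hi)]
        simp

variable {φ : OrliczFunction} {g : OrliczSpace φ μ →ₗ[ℝ] ℝ}

/-- The tails `a(J n) 1_{J n ≥ K}` are uniformly small under an order continuous functional: along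
a choice of indices `n` with `K → ∞` the tails are dominated by their supremum, the modular of
which is controlled by the sum of the modulars. -/
theorem exists_forall_abs_tail_lt (hJ : IsIID J ν μ) (hg : IsOrderContinuous g) {a : ℕ → ℝ≥0}
    (hν : ∑' j : ℕ, ((j : ℝ≥0∞) + 1) * ν {j} ≠ ∞)
    (hφ : ∑' j : ℕ, ((j : ℝ≥0∞) + 1) * φ (a j) * ν {j} ≤ 1)
    {v : ℕ → ℕ → OrliczSpace φ μ}
    (hv : ∀ K n, ∀ᵐ x ∂μ, (v K n : α →ₘ[μ] ℝ) x = if K ≤ J n x then (a (J n x) : ℝ) else 0)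
    {ε : ℝ} (hε : 0 < ε) (K₀ : ℕ) : ∃ K, K₀ ≤ K ∧ ∀ n, |g (v K n)| < ε := by
  by_contra! hcon
  choose n hn using fun i : ℕ => hcon (K₀ + i) le_self_add
  have hK : ∀ i, i ≤ K₀ + i := fun i => le_add_self
  set w : ℕ → α → ℝ := fun i x => if K₀ + i ≤ J (n i) x then (a (J (n i) x) : ℝ) else 0 with hw
  have hw0 : ∀ i x, 0 ≤ w i x := fun i x => by
    simp only [hw]
    split_ifs <;> simp
  have hwm : ∀ i, Measurable (w i) := fun i =>
    (measurable_of_countable fun j : ℕ => if K₀ + i ≤ j then (a j : ℝ) else 0).comp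
      (hJ.measurable _)
  have hfin : ∀ᵐ x ∂μ, {i | K₀ + i ≤ J (n i) x}.Finite := by
    refine ae_finite_setOfPred_mem (μ := μ) (s := fun i => {x | K₀ + i ≤ J (n i) x}) ?_
    have h := hJ.tsum_lintegral_truncation_le (fun _ => 1) n (fun i => K₀ + i) hK
    simp only [mul_one] at h
    refine ne_top_of_le_ne_top hν (le_trans (le_of_eq ?_) h)
    refine tsum_congr fun i => ?_
    rw [← lintegral_indicator_one (measurableSet_le measurable_const (hJ.measurable _))]
    refine lintegral_congr fun x => ?_
    simp [Set.indicator_apply]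
  have hsupp : ∀ i x, w i x ≠ 0 → i ∈ {i | K₀ + i ≤ J (n i) x} := fun i x h => by
    by_contra h'
    exact h (if_neg h')
  have hrange : ∀ x, {i | K₀ + i ≤ J (n i) x}.Finite → (Set.range fun i => w i x).Finite := by
    refine fun x hx => ((hx.image fun i => w i x).insert 0).subset ?_
    rintro _ ⟨i, rfl⟩
    rcases eq_or_ne (w i x) 0 with h | h
    · exact Or.inl h
    · exact Or.inr ⟨i, hsupp i x h, rfl⟩
  set V : α → ℝ := fun x => ⨆ i, w i x with hV
  have hVm : AEStronglyMeasurable V μ := (Measurable.iSup hwm).aestronglyMeasurable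
  have hVφ : ∫⁻ x, (φ ‖V x‖₊ : ℝ≥0∞) ∂μ ≤ 1 := by
    calc ∫⁻ x, (φ ‖V x‖₊ : ℝ≥0∞) ∂μ ≤ ∫⁻ x, ∑' i, (φ ‖w i x‖₊ : ℝ≥0∞) ∂μ := by
          refine lintegral_mono_ae ?_
          filter_upwards [hfin] with x hx
          -- Almost everywhere only finitely many terms are nonzero, so the supremum is attained.
          obtain ⟨i, hi⟩ : V x ∈ Set.range fun i => w i x :=
            (Set.range_nonempty _).csSup_mem (hrange x hx)
          rw [← hi]
          exact ENNReal.le_tsum i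
      _ = ∑' i, ∫⁻ x, (φ ‖w i x‖₊ : ℝ≥0∞) ∂μ :=
          lintegral_tsum fun i =>
            (φ.mono.measurable.comp (hwm i).nnnorm).coe_nnreal_ennreal.aemeasurable
      _ = ∑' i, ∫⁻ x, (if K₀ + i ≤ J (n i) x then (φ (a (J (n i) x)) : ℝ≥0∞) else 0) ∂μ := by
          refine tsum_congr fun i => lintegral_congr fun x => ?_
          simp only [hw]
          split_ifs <;> simp [φ.map_zero]
      _ ≤ 1 := (hJ.tsum_lintegral_truncation_le (fun j => (φ (a j) : ℝ≥0∞)) n _ hK).trans hφ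
  have hmem : AEEqFun.mk V hVm ∈ OrliczSpace φ μ :=
    (OrliczSpace.luxemburgNorm_mk_le_one hVm hVφ).trans_lt ENNReal.one_lt_top
  have key := hg.tendsto_of_dominated (f := fun i => v (K₀ + i) (n i)) (V := ⟨_, hmem⟩)
    (fun i => by
      filter_upwards [hv (K₀ + i) (n i), AEEqFun.coeFn_mk V hVm, hfin] with x h1 h2 h3
      rw [h1, h2]
      exact (abs_of_nonneg (hw0 i x)).le.trans (le_ciSup (hrange x h3).bddAbove i))
    (by
      filter_upwards [ae_all_iff.2 fun i => hv (K₀ + i) (n i), hfin] with x h1 h2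
      obtain ⟨N, hN⟩ := h2.bddAbove
      refine tendsto_const_nhds.congr' ?_
      filter_upwards [eventually_gt_atTop N] with i hi
      rw [h1 i]
      exact (if_neg fun h : K₀ + i ≤ J (n i) x => absurd (hN h) (not_le.2 hi)).symm)
  obtain ⟨i, hi⟩ := ((Metric.tendsto_nhds.1 key) ε hε).exists
  rw [Real.dist_eq, sub_zero] at hi
  exact absurd (hn i) (not_le.2 hi)

variable [IsProbabilityMeasure μ]

/-- By the strong law of large numbers the Cesàro means of every subsequence of a bounded i.i.d.
sequence converge almost everywhere to the expectation, hence in order since the constants belong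
to `L^φ(μ)`; so an order continuous functional takes the expected limit on the sequence. -/
theorem tendsto_of_bounded (hJ : IsIID J ν μ) (hg : IsOrderContinuous g) {b : ℕ → ℝ} {C : ℝ}
    (hb : ∀ j, |b j| ≤ C) {f : ℕ → OrliczSpace φ μ}
    (hf : ∀ n, ∀ᵐ x ∂μ, (f n : α →ₘ[μ] ℝ) x = b (J n x)) :
    Tendsto (fun n => g (f n)) atTop (𝓝 ((∫ j, b j ∂ν) * g (OrliczSpace.const φ μ 1))) := by
  set E := ∫ j, b j ∂ν with hE
  refine tendsto_of_forall_tendsto_cesaro fun k hk => ?_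
  have hJk := hJ.comp hk
  have hbm : Measurable b := measurable_of_countable b
  have hmean : ∀ n, ∫ x, b (J n x) ∂μ = E := fun n => by
    rw [hE, ← hJ.map_eq n, integral_map (hJ.measurable n).aemeasurable
      hbm.aestronglyMeasurable]
  have hslln : ∀ᵐ x ∂μ, Tendsto (fun n : ℕ => (∑ i ∈ Finset.range n, b (J (k i) x)) / n) atTop
      (𝓝 E) := by
    have h := strong_law_ae_real (μ := μ) (fun i x => b (J (k i) x))
      (Integrable.of_bound (hbm.comp (hJ.measurable _)).aestronglyMeasurable C
        (Eventually.of_forall fun x => hb _))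
      (fun m n hmn => (hJk.indep hmn).comp hbm hbm)
      (fun i => IdentDistrib.comp ⟨(hJk.measurable i).aemeasurable, (hJk.measurable 0).aemeasurable,
        by rw [hJk.map_eq, hJk.map_eq]⟩ hbm)
    simpa only [hmean] using h
  have hf' : ∀ᵐ x ∂μ, ∀ n, (f n : α →ₘ[μ] ℝ) x = b (J n x) := ae_all_iff.2 hf
  have hval : ∀ m, ∀ᵐ x ∂μ,
      ((cesaro (f ∘ k) m + OrliczSpace.const φ μ (-E) : OrliczSpace φ μ) : α →ₘ[μ] ℝ) x =
        (∑ i ∈ Finset.range (m + 1), b (J (k i) x)) / ((m + 1 : ℕ) : ℝ) - E := by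
    intro m
    filter_upwards [hf', OrliczSpace.coeFn_add (cesaro (f ∘ k) m) (OrliczSpace.const φ μ (-E)),
      OrliczSpace.coeFn_cesaro (f ∘ k) m, OrliczSpace.coeFn_const (φ := φ) (μ := μ) (-E)]
      with x h1 h2 h3 h4
    rw [h2, h3, h4, div_eq_inv_mul, Nat.cast_add_one, sub_eq_add_neg]
    simp only [Function.comp_apply, h1]
  have key := hg.tendsto_of_dominated (V := OrliczSpace.const φ μ (C + |E|))
    (f := fun m => cesaro (f ∘ k) m + OrliczSpace.const φ μ (-E)) (fun m => by
      filter_upwards [hval m, OrliczSpace.coeFn_const (φ := φ) (μ := μ) (C + |E|)] with x h1 h2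
      rw [h1, h2]
      refine (abs_sub _ _).trans (add_le_add_left ?_ _)
      rw [abs_div, Nat.abs_cast, div_le_iff₀ (by positivity)]
      refine (Finset.abs_sum_le_sum_abs _ _).trans ?_
      refine (Finset.sum_le_card_nsmul _ _ C fun i _ => hb _).trans (le_of_eq ?_)
      rw [Finset.card_range, nsmul_eq_mul, mul_comm]) (by
      filter_upwards [hslln, ae_all_iff.2 hval] with x h1 h2
      simp only [h2]
      have h3 := (h1.comp (tendsto_add_atTop_nat 1)).sub_const E
      rw [sub_self] at h3
      exact h3)
  have h2 := key.add_const (E * g (OrliczSpace.const φ μ 1))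
  rw [zero_add] at h2
  refine h2.congr fun m => ?_
  rw [map_add, map_cesaro, OrliczSpace.const_eq_smul, map_smul, smul_eq_mul]
  simp only [Function.comp_def]
  ring

/-- Order continuous functionals see an i.i.d. sequence in the limit as its expectation. -/
theorem tendsto_map (hJ : IsIID J ν μ) (hg : IsOrderContinuous g) {a : ℕ → ℝ≥0}
    (hν : ∑' j : ℕ, ((j : ℝ≥0∞) + 1) * ν {j} ≠ ∞)
    (hφ : ∑' j : ℕ, ((j : ℝ≥0∞) + 1) * φ (a j) * ν {j} ≤ 1)
    (ha : Integrable (fun j => (a j : ℝ)) ν) {F : ℕ → OrliczSpace φ μ}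
    (hF : ∀ n, ∀ᵐ x ∂μ, (F n : α →ₘ[μ] ℝ) x = a (J n x)) :
    Tendsto (fun n => g (F n)) atTop
      (𝓝 ((∫ j, (a j : ℝ) ∂ν) * g (OrliczSpace.const φ μ 1))) := by
  set b : ℕ → ℕ → ℝ := fun K j => if K ≤ j then 0 else (a j : ℝ) with hb
  have hbm : ∀ K n, AEStronglyMeasurable (fun x => b K (J n x)) μ := fun K n =>
    ((measurable_of_countable (b K)).comp (hJ.measurable n)).aestronglyMeasurable
  have hbF : ∀ K n, AEEqFun.mk _ (hbm K n) ∈ OrliczSpace φ μ := fun K n => by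
    refine OrliczSpace.mem_of_ae_abs_le (g := F n) ?_
    filter_upwards [AEEqFun.coeFn_mk _ (hbm K n), hF n] with x h1 h2
    rw [h1, h2]
    simp only [hb]
    split_ifs <;> simp
  let u : ℕ → ℕ → OrliczSpace φ μ := fun K n => ⟨_, hbF K n⟩
  have hu : ∀ K n, ∀ᵐ x ∂μ, (u K n : α →ₘ[μ] ℝ) x = b K (J n x) := fun K n =>
    AEEqFun.coeFn_mk _ (hbm K n)
  have hv : ∀ K n, ∀ᵐ x ∂μ, ((F n - u K n : OrliczSpace φ μ) : α →ₘ[μ] ℝ) x =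
      if K ≤ J n x then (a (J n x) : ℝ) else 0 := fun K n => by
    filter_upwards [hu K n, hF n,
      AEEqFun.coeFn_sub (F n : α →ₘ[μ] ℝ) (u K n : α →ₘ[μ] ℝ)] with x h1 h2 h3
    refine h3.trans ?_
    rw [Pi.sub_apply, h1, h2]
    simp only [hb]
    split_ifs <;> simp
  have hbC : ∀ K j, |b K j| ≤ ((∑ i ∈ Finset.range K, a i : ℝ≥0) : ℝ) := by
    intro K j
    simp only [hb]
    split_ifs with h
    · rw [abs_zero]
      exact NNReal.coe_nonneg _
    · rw [abs_of_nonneg (NNReal.coe_nonneg (a j)), NNReal.coe_le_coe]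
      exact Finset.single_le_sum (fun i _ => zero_le)
        (Finset.mem_range.2 (not_le.1 h))
  have hmean : Tendsto (fun K => (∫ j, b K j ∂ν) * g (OrliczSpace.const φ μ 1)) atTop
      (𝓝 ((∫ j, (a j : ℝ) ∂ν) * g (OrliczSpace.const φ μ 1))) := by
    refine Tendsto.mul_const _ (tendsto_integral_of_dominated_convergence (fun j => (a j : ℝ))
      (fun K => (measurable_of_countable (b K)).aestronglyMeasurable) ha
      (fun K => Eventually.of_forall fun j => ?_) (Eventually.of_forall fun j => ?_))
    · simp only [hb]
      split_ifs <;> simp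
    · refine tendsto_const_nhds.congr' ?_
      filter_upwards [eventually_gt_atTop j] with K hK
      exact (if_neg (not_le.2 hK)).symm
  rw [Metric.tendsto_nhds]
  intro ε hε
  obtain ⟨K₀, hK₀⟩ := eventually_atTop.1 (Metric.tendsto_nhds.1 hmean (ε / 3) (by positivity))
  obtain ⟨K, hK, htail⟩ := hJ.exists_forall_abs_tail_lt hg hν hφ hv (ε := ε / 3)
    (by positivity) K₀
  filter_upwards [Metric.tendsto_nhds.1 (hJ.tendsto_of_bounded hg (hbC K) (hu K)) (ε / 3)
    (by positivity)] with n h1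
  have h2 := hK₀ K hK
  have h3 := htail n
  rw [map_sub] at h3
  rw [Real.dist_eq] at h1 h2 ⊢
  rw [abs_lt] at *
  constructor <;> linarith [h1.1, h1.2, h2.1, h2.2, h3.1, h3.2]

/-- If `P(J = j) L ≤ 1/2`, then the sets on which `j` is attained at time `m` but at no earlier
time in `[j, L)` have at least half the probability of `{J m = j}`. -/
theorem half_le_measure_first (hJ : IsIID J ν μ) {j L m : ℕ} (hL : ν {j} * L ≤ 2⁻¹)
    (hm : m ∈ Finset.Ico j L) :
    ν {j} / 2 ≤ μ ({x | J m x = j} \ ⋃ i ∈ Finset.Ico j m, {x | J i x = j}) := by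
  have hp : ν {j} ≠ ∞ := by
    rw [← hJ.measure_eq 0]
    exact measure_ne_top _ _
  have h1 : μ ({x | J m x = j} ∩ ⋃ i ∈ Finset.Ico j m, {x | J i x = j}) ≤ ν {j} / 2 := by
    rw [Set.inter_iUnion₂]
    calc _ ≤ ∑ i ∈ Finset.Ico j m, μ ({x | J m x = j} ∩ {x | J i x = j}) :=
          measure_biUnion_finset_le _ _
      _ = ∑ i ∈ Finset.Ico j m, ν {j} * ν {j} :=
          Finset.sum_congr rfl fun i hi => hJ.measure_inter (Finset.mem_Ico.1 hi).2.ne' j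
      _ = ν {j} * (ν {j} * (m - j : ℕ)) := by
          rw [Finset.sum_const, Nat.card_Ico, nsmul_eq_mul]
          ring
      _ ≤ ν {j} * (ν {j} * L) := by
          gcongr
          exact (Nat.sub_le _ _).trans (Finset.mem_Ico.1 hm).2.le
      _ ≤ ν {j} * 2⁻¹ := by gcongr
      _ = ν {j} / 2 := rfl
  have h2 := measure_le_inter_add_sdiff μ {x | J m x = j} (⋃ i ∈ Finset.Ico j m, {x | J i x = j})
  rw [hJ.measure_eq, ← ENNReal.add_halves (ν {j})] at h2
  exact (ENNReal.add_le_add_iff_left (ENNReal.div_ne_top hp two_ne_zero)).1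
    (h2.trans (add_le_add_left h1 _))

/-- The maximal function `sup_m a(J m) / (2 m + 2)` does not belong to `L^φ(μ)`, even if finitely
many terms are left out. Its modular is bounded from below on the disjoint sets where the value
`j` is attained for the first time in `[j, L j)`. -/
theorem not_forall_le_linear_growth (hJ : IsIID J ν μ) {a : ℕ → ℝ≥0} {L : ℕ → ℕ}
    (hL : ∀ j, 1 ≤ j → ν {j} * L j ≤ 2⁻¹)
    (hsum : ∀ j, 1 ≤ j → 2 < ∑ m ∈ Finset.Ico j (L j), ν {j} * φ (a j / (j * (m + 1))))
    (H : OrliczSpace φ μ) (M : ℕ) :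
    ¬ ∀ m, M ≤ m → ∀ᵐ x ∂μ, (a (J m x) : ℝ) ≤ (2 * m + 2) * (H : α →ₘ[μ] ℝ) x := by
  intro hH
  obtain ⟨c, hc, hmod, -⟩ := exists_of_luxemburgNorm_lt H.2
  -- With `2 c ≤ j` the factor `1 / c` in the modular is absorbed into the `j` of `hsum`.
  obtain ⟨N, hN⟩ := exists_nat_ge (2 * c)
  obtain ⟨j, hj1, hjM, hjN⟩ : ∃ j : ℕ, 1 ≤ j ∧ M ≤ j ∧ N ≤ j :=
    ⟨1 + M + N, by omega, by omega, by omega⟩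
  have hjc : 2 * c ≤ j := hN.trans (by exact_mod_cast hjN)
  have hj0 : (0 : ℝ≥0) < j := by exact_mod_cast hj1
  set D : ℕ → Set α := fun m =>
    {x | J m x = j} \ ⋃ i ∈ Finset.Ico j m, {x | J i x = j} with hD
  have hA : ∀ i, MeasurableSet {x | J i x = j} := fun i =>
    hJ.measurable i (measurableSet_singleton j)
  have hDm : ∀ m, MeasurableSet (D m) := fun m =>
    (hA m).diff (Finset.measurableSet_biUnion _ fun i _ => hA i)
  have hdisj : ∀ x, ∀ m ∈ Finset.Ico j (L j), ∀ i ∈ Finset.Ico j (L j), x ∈ D m → x ∈ D i →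
      i = m := by
    intro x m hm i hi hxm hxi
    rcases lt_trichotomy i m with h | h | h
    · exact absurd (Set.mem_biUnion (Finset.mem_Ico.2 ⟨(Finset.mem_Ico.1 hi).1, h⟩) hxi.1) hxm.2
    · exact h
    · exact absurd (Set.mem_biUnion (Finset.mem_Ico.2 ⟨(Finset.mem_Ico.1 hm).1, h⟩) hxm.1) hxi.2
  set B : ℕ → ℝ≥0 := fun m => φ (a j / (j * (m + 1))) with hB
  have hpt : ∀ᵐ x ∂μ, ∑ m ∈ Finset.Ico j (L j), (D m).indicator (fun _ => (B m : ℝ≥0∞)) x ≤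
      φ (‖(H : α →ₘ[μ] ℝ) x‖₊ / c) := by
    have hH' : ∀ᵐ x ∂μ, ∀ m, M ≤ m →
        (a (J m x) : ℝ) ≤ (2 * m + 2) * (H : α →ₘ[μ] ℝ) x := by
      rw [ae_all_iff]
      intro m
      by_cases hm : M ≤ m
      · filter_upwards [hH m hm] with x hx _ using hx
      · exact Eventually.of_forall fun x h => absurd h hm
    filter_upwards [hH'] with x hx
    by_cases hex : ∃ m ∈ Finset.Ico j (L j), x ∈ D m
    · obtain ⟨m, hm, hxm⟩ := hex
      rw [Finset.sum_eq_single m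
        (fun i hi hne => Set.indicator_of_notMem (fun h => hne (hdisj x m hm i hi hxm h)) _)
        (fun h => absurd hm h), Set.indicator_of_mem hxm]
      refine ENNReal.coe_le_coe.2 (φ.mono ?_)
      have h1 : a j ≤ (2 * m + 2) * ‖(H : α →ₘ[μ] ℝ) x‖₊ := by
        have h2 := hx m (hjM.trans (Finset.mem_Ico.1 hm).1)
        rw [show J m x = j from hxm.1] at h2
        rw [← NNReal.coe_le_coe]
        push_cast
        exact h2.trans (by gcongr; exact le_abs_self _)
      rw [div_le_div_iff₀ (by positivity) hc]
      calc a j * c ≤ (2 * m + 2) * ‖(H : α →ₘ[μ] ℝ) x‖₊ * c := by gcongr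
        _ = ‖(H : α →ₘ[μ] ℝ) x‖₊ * (2 * c * (m + 1)) := by ring
        _ ≤ ‖(H : α →ₘ[μ] ℝ) x‖₊ * (j * (m + 1)) := by gcongr
    · push Not at hex
      rw [Finset.sum_eq_zero fun m hm => Set.indicator_of_notMem (hex m hm) _]
      exact zero_le
  have hint : ∑ m ∈ Finset.Ico j (L j), (B m : ℝ≥0∞) * μ (D m) ≤ 1 := by
    refine le_trans (le_of_eq ?_) ((lintegral_mono_ae hpt).trans hmod)
    rw [lintegral_finsetSum _ fun m _ => measurable_const.indicator (hDm m)]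
    refine Finset.sum_congr rfl fun m _ => ?_
    rw [lintegral_indicator_const (hDm m)]
  have hlow : (∑ m ∈ Finset.Ico j (L j), ν {j} * (B m : ℝ≥0∞)) / 2 ≤ 1 := by
    refine le_trans ?_ hint
    rw [div_eq_mul_inv, Finset.sum_mul]
    refine Finset.sum_le_sum fun m hm => ?_
    calc ν {j} * (B m : ℝ≥0∞) * 2⁻¹ = B m * (ν {j} / 2) := by rw [div_eq_mul_inv]; ring
      _ ≤ B m * μ (D m) := by
        gcongr
        exact hJ.half_le_measure_first (hL j hj1) hm
  rw [ENNReal.div_le_iff two_ne_zero ENNReal.ofNat_ne_top, one_mul] at hlow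
  exact absurd (hsum j hj1) (not_lt.2 hlow)

end IsIID

/-! ### The sequence without order convergent Cesàro means -/

/-- The layers of `IsNearlyLinear.exists_layer` for all `j ≥ 1` fit together into one distribution
`ν` on `ℕ`; the remaining mass is put at `0`, where `a` vanishes. -/
theorem OrliczFunction.IsNearlyLinear.exists_distribution {φ : OrliczFunction}
    (h : φ.IsNearlyLinear) :
    ∃ (ν : Measure ℕ) (_ : IsProbabilityMeasure ν) (a : ℕ → ℝ≥0) (L : ℕ → ℕ),
      ∑' j : ℕ, ((j : ℝ≥0∞) + 1) * ν {j} ≠ ∞ ∧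
      ∑' j : ℕ, ((j : ℝ≥0∞) + 1) * φ (a j) * ν {j} ≤ 1 ∧
      Integrable (fun j => (a j : ℝ)) ν ∧
      (∀ j, 1 ≤ j → ν {j} * L j ≤ 2⁻¹) ∧
      ∀ j, 1 ≤ j → 2 < ∑ m ∈ Finset.Ico j (L j), ν {j} * φ (a j / (j * (m + 1))) := by
  -- The layer with number `j = i + 1` has budget `η i`, so that `∑ (j + 1) η i = ∑ 2⁻¹ ^ j = 1`.
  set η : ℕ → ℝ≥0 := fun i => 2⁻¹ ^ (i + 1) / (i + 2) with hη
  have hη0 : ∀ i, 0 < η i := fun i => by positivity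
  choose a p L hp hpφ hpa hpL hsum using fun i : ℕ =>
    h.exists_layer (j := i + 1) (by omega) (hη0 i)
  have hgeom : ∑' i : ℕ, ((2⁻¹ ^ (i + 1) : ℝ≥0) : ℝ≥0∞) = 1 := by
    push_cast
    exact ENNReal.tsum_geometric_add_one _ |>.trans (by
      rw [ENNReal.one_sub_inv_two, inv_inv]
      exact ENNReal.inv_mul_cancel two_ne_zero ENNReal.ofNat_ne_top)
  have hbound : ∀ q : ℕ → ℝ≥0, (∀ i, q i ≤ η i) →
      ∑' i : ℕ, ((i : ℝ≥0∞) + 2) * q i ≤ 1 := by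
    intro q hq
    rw [← hgeom]
    refine ENNReal.tsum_le_tsum fun i => ?_
    have : ((i : ℝ≥0) + 2) * q i ≤ 2⁻¹ ^ (i + 1) := by
      rw [mul_comm, ← le_div_iff₀ (by positivity)]
      exact hq i
    exact_mod_cast this
  have hbound' : ∀ q : ℕ → ℝ≥0, (∀ i, q i ≤ η i) → ∑' i : ℕ, (q i : ℝ≥0∞) ≤ 1 := by
    refine fun q hq => le_trans (ENNReal.tsum_le_tsum fun i => ?_) (hbound q hq)
    exact le_mul_of_one_le_left zero_le (le_add_self.trans' (by norm_num))
  let w : ℕ → ℝ≥0∞ := fun j => Nat.casesOn j (1 - ∑' i, (p i : ℝ≥0∞)) fun i => p i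
  have hw : HasSum w 1 := by
    rw [ENNReal.summable.hasSum_iff, tsum_eq_zero_add' ENNReal.summable]
    exact tsub_add_cancel_of_le (hbound' p hp)
  let P : PMF ℕ := ⟨w, hw⟩
  have hP : ∀ j, P.toMeasure {j} = w j := fun j =>
    P.toMeasure_apply_singleton j (measurableSet_singleton j)
  refine ⟨P.toMeasure, inferInstance, fun j => Nat.casesOn j 0 a, fun j => Nat.casesOn j 0 L,
    ?_, ?_, ?_, ?_, ?_⟩
  · simp_rw [hP]
    rw [tsum_eq_zero_add' ENNReal.summable]
    refine ENNReal.add_ne_top.2 ⟨?_, ne_top_of_le_ne_top ENNReal.one_ne_top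
      (le_of_eq_of_le (tsum_congr fun i => ?_) (hbound p hp))⟩
    · have h0 : w 0 ≤ 1 := tsub_le_self
      simpa using ne_top_of_le_ne_top ENNReal.one_ne_top h0
    · change (((i + 1 : ℕ) : ℝ≥0∞) + 1) * p i = _
      push_cast
      ring
  · simp_rw [hP]
    rw [tsum_eq_zero_add' ENNReal.summable]
    have h0 : (((0 : ℕ) : ℝ≥0∞) + 1) * φ 0 * w 0 = 0 := by simp [φ.map_zero]
    refine le_of_eq_of_le ?_ (hbound (fun i => p i * φ (a i)) hpφ)
    refine (congrArg (· + _) h0).trans ((zero_add _).trans (tsum_congr fun i => ?_))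
    change (((i + 1 : ℕ) : ℝ≥0∞) + 1) * φ (a i) * p i = _
    push_cast
    ring
  · refine ⟨(measurable_of_countable _).aestronglyMeasurable, ?_⟩
    rw [hasFiniteIntegral_iff_enorm, lintegral_countable']
    simp_rw [hP]
    rw [tsum_eq_zero_add' ENNReal.summable]
    refine lt_of_le_of_lt ?_ ENNReal.one_lt_top
    refine le_of_eq_of_le ?_ (hbound' (fun i => p i * a i) hpa)
    have h0 : ‖((0 : ℝ≥0) : ℝ)‖ₑ * w 0 = 0 := by simp
    refine (congrArg (· + _) h0).trans ((zero_add _).trans (tsum_congr fun i => ?_))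
    change ‖((a i : ℝ≥0) : ℝ)‖ₑ * p i = _
    push_cast
    rw [mul_comm]
    simp [enorm_eq_nnnorm]
  · rintro (_ | i) hj
    · omega
    · rw [hP]
      change (p i : ℝ≥0∞) * L i ≤ 2⁻¹
      have := ENNReal.coe_le_coe.2 (hpL i)
      push_cast at this
      exact this
  · rintro (_ | i) hj
    · omega
    · rw [hP]
      change 2 < ∑ m ∈ Finset.Ico (i + 1) (L i),
        (p i : ℝ≥0∞) * φ (a i / ((i + 1 : ℕ) * (m + 1)))
      have := ENNReal.coe_lt_coe.2 (hsum i)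
      push_cast at this ⊢
      exact this

/-- The centred i.i.d. sequence `a(J n) - E a(J 0)` is bounded and `σ_n`-null, but no subsequence
has order bounded, let alone order convergent, Cesàro means. -/
theorem OrliczFunction.IsNearlyLinear.not_hasSigmaNOrderBanachSaks {φ : OrliczFunction}
    (h : φ.IsNearlyLinear) :
    ¬ HasSigmaNOrderBanachSaks (OrliczSpace φ (volume : Measure unitInterval)) := by
  intro hX
  obtain ⟨ν, _, a, L, hν, hφ, ha, hL, hsum⟩ := h.exists_distribution
  obtain ⟨J, hJ⟩ := exists_isIID_unitInterval ν
  set μ : Measure unitInterval := volume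
  set E := ∫ j, (a j : ℝ) ∂ν
  have hFm : ∀ n, AEStronglyMeasurable (fun x => (a (J n x) : ℝ)) μ := fun n =>
    ((measurable_of_countable fun j => (a j : ℝ)).comp (hJ.measurable n)).aestronglyMeasurable
  have hFn : ∀ n, luxemburgNorm φ μ (AEEqFun.mk _ (hFm n)) ≤ 1 := by
    refine fun n => OrliczSpace.luxemburgNorm_mk_le_one (hFm n) (le_trans ?_ hφ)
    simp only [NNReal.nnnorm_eq]
    rw [hJ.lintegral_comp (fun j => (φ (a j) : ℝ≥0∞)) n]
    refine ENNReal.tsum_le_tsum fun j => ?_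
    gcongr
    exact le_mul_of_one_le_left zero_le le_add_self
  let F : ℕ → OrliczSpace φ μ := fun n =>
    ⟨AEEqFun.mk _ (hFm n), (hFn n).trans_lt ENNReal.one_lt_top⟩
  have hF : ∀ n, ∀ᵐ x ∂μ, (F n : unitInterval →ₘ[μ] ℝ) x = a (J n x) := fun n =>
    AEEqFun.coeFn_mk _ (hFm n)
  set e := OrliczSpace.const φ μ E with he
  obtain ⟨k, hk, y, hy⟩ := hX (fun n => F n - e) ⟨1 + ‖e‖, fun n => by
      refine (norm_sub_le _ _).trans (add_le_add_left ?_ _)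
      exact ENNReal.toReal_mono ENNReal.one_ne_top (hFn n)⟩ (by
    rw [nhds_induced, tendsto_comap_iff, tendsto_pi_nhds]
    rintro ⟨g, hg⟩
    have h1 := (hJ.tendsto_map hg hν hφ ha hF).sub_const (E * g (OrliczSpace.const φ μ 1))
    rw [sub_self] at h1
    simp only [Function.comp_apply, map_sub, he]
    rw [OrliczSpace.const_eq_smul, map_smul, smul_eq_mul, g.map_zero]
    exact h1)
  obtain ⟨H, M, hH⟩ := hy.exists_le_nsmul
  refine (hJ.comp hk).not_forall_le_linear_growth hL hsum (H + |e|) M fun m hm => ?_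
  have h1 : F (k m) ≤ ((2 * m + 2 : ℕ) : ℝ) • (H + |e|) := by
    rw [Nat.cast_smul_eq_nsmul, nsmul_add]
    have h2 : e ≤ (2 * m + 2) • |e| :=
      (le_abs_self e).trans (le_self_nsmul (abs_nonneg e) (by omega))
    exact (sub_le_iff_le_add.1 (hH m hm)).trans (add_le_add_right h2 _)
  filter_upwards [OrliczSpace.le_iff_ae.1 h1, hF (k m),
    OrliczSpace.coeFn_smul ((2 * m + 2 : ℕ) : ℝ) (H + |e|)] with x h2 h3 h4
  rw [← h3]
  refine h2.trans (le_of_eq ?_)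
  rw [h4]
  push_cast
  rfl

/-- `L¹[0,1]` fails the `σ_n`-order Banach-Saks property, and so does `L^φ[0,1]` for every Orlicz
function `φ` whose conjugate fails the `Δ₂`-condition. -/
theorem proposition5p5 :
    ¬ HasSigmaNOrderBanachSaks (Lp ℝ 1 (volume : Measure unitInterval)) ∧
    ∀ φ : OrliczFunction, ¬ DeltaTwo φ.conj →
      ¬ HasSigmaNOrderBanachSaks (OrliczSpace φ (volume : Measure unitInterval)) :=
  ⟨fun h => OrliczFunction.isNearlyLinear_linear.not_hasSigmaNOrderBanachSaks
      (OrliczFunction.hasSigmaNOrderBanachSaks_linear h),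
    fun φ hφ => (φ.isNearlyLinear_of_not_deltaTwo_conj hφ).not_hasSigmaNOrderBanachSaks⟩
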